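/- Let $k$ be an algebraically closed field of arbitrary characteristic and let $H$ be a finite-dimensional Hopf algebra over $k$ with comultiplication $\Delta$, counit $\varepsilon$ and antipode $S$. A \emph{twist} for $H$ is an invertible element $J=\sum J^{(1)}\otimes J^{(2)}\in H\otimes H$ such that $$(\Delta\otimes \mathrm{id})(J)\,(J\otimes 1) = (\mathrm{id}\otimes\Delta)(J)\,(1\otimes J).$$ The twisted Hopf algebra $H^J$ has the algebra structure and the counit of $H$, the comultiplication $\Delta^J(h)=J^{-1}\Delta(h)J$, and the antipode $S^J(h)=Q_J^{-1}S(h)Q_J$, where $Q_J=\sum S(J^{(1)})J^{(2)}$. A coalgebra is \emph{cosemisimple} if it is the sum of its simple subcoalgebras, and a finite-dimensional Hopf algebra is \emph{unimodular} if its left integrals (elements $t$ with $ht=\varepsilon(h)t$ for all $h$) and its right integrals (elements $t$ with $th=\varepsilon(h)t$ for all $h$) coincide. If $H$ is cosemisimple and unimodular, then for every twist $J$ for $H$ the Hopf algebra $H^J$ is again cosemisimple and unimodular. -/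

import Mathlib

open scoped TensorProduct

section Coalgebras

variable (k : Type*) {C : Type*} [Field k] [AddCommGroup C] [Module k C] [Coalgebra k C]

/-- A subspace `D` of a coalgebra `C` is a subcoalgebra if `Δ(D) ⊆ D ⊗ D`, where `D ⊗ D` is
identified with its image in `C ⊗ C`. -/
def IsSubcoalgebra (D : Submodule k C) : Prop :=
  ∀ x ∈ D, Coalgebra.comul (R := k) x ∈ LinearMap.range (TensorProduct.mapIncl D D)

/-- A simple subcoalgebra: a nonzero subcoalgebra whose only subcoalgebras are `0` and itself. -/
def IsSimpleSubcoalgebra (D : Submodule k C) : Prop :=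
  IsSubcoalgebra k D ∧ D ≠ ⊥ ∧ ∀ E : Submodule k C, IsSubcoalgebra k E → E ≤ D → E = ⊥ ∨ E = D

variable (C) in
/-- A coalgebra is cosemisimple if it is the sum of its simple subcoalgebras
(this sum is then automatically direct). -/
def IsCosemisimple : Prop :=
  sSup {D : Submodule k C | IsSimpleSubcoalgebra k D} = ⊤

end Coalgebras

section Integrals

variable (k H : Type*) [Field k] [Ring H] [HopfAlgebra k H]

/-- The left integrals in `H`: elements `t` with `h t = ε(h) t` for all `h`. -/
def leftIntegrals : Submodule k H where
  carrier := {t | ∀ h : H, h * t = Coalgebra.counit (R := k) h • t}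
  add_mem' ha hb h := by rw [mul_add, smul_add, ha h, hb h]
  zero_mem' h := by simp
  smul_mem' c t ht h := by rw [mul_smul_comm, ht h, smul_comm]

/-- The right integrals in `H`: elements `t` with `t h = ε(h) t` for all `h`. -/
def rightIntegrals : Submodule k H where
  carrier := {t | ∀ h : H, t * h = Coalgebra.counit (R := k) h • t}
  add_mem' ha hb h := by rw [add_mul, smul_add, ha h, hb h]
  zero_mem' h := by simp
  smul_mem' c t ht h := by rw [smul_mul_assoc, ht h, smul_comm]

/-- `H` is unimodular if its left and right integrals coincide. -/
def IsUnimodular : Prop :=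
  leftIntegrals k H = rightIntegrals k H

end Integrals

noncomputable section

/-- A (Drinfeld) twist for a Hopf algebra `H`: an invertible element `J` of the algebra `H ⊗ H`
with `(Δ ⊗ id)(J) (J ⊗ 1) = (id ⊗ Δ)(J) (1 ⊗ J)`. -/
structure HopfTwist (k H : Type*) [Field k] [Ring H] [HopfAlgebra k H] where
  /-- The element `J` together with its inverse. -/
  elt : (H ⊗[k] H)ˣ
  twist_eq :
    Algebra.TensorProduct.assoc k k k H H H
        (Algebra.TensorProduct.map (Bialgebra.comulAlgHom k H) (AlgHom.id k H) (elt : H ⊗[k] H) *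
          ((elt : H ⊗[k] H) ⊗ₜ[k] (1 : H))) =
      Algebra.TensorProduct.map (AlgHom.id k H) (Bialgebra.comulAlgHom k H) (elt : H ⊗[k] H) *
        ((1 : H) ⊗ₜ[k] (elt : H ⊗[k] H))

namespace HopfTwist

variable {k H : Type*} [Field k] [Ring H] [HopfAlgebra k H]

/-- The twisted comultiplication `Δ^J(h) = J⁻¹ Δ(h) J`. -/
def comul (J : HopfTwist k H) : H →ₗ[k] H ⊗[k] H :=
  LinearMap.mulLeft k (↑J.elt⁻¹ : H ⊗[k] H) ∘ₗ LinearMap.mulRight k (J.elt : H ⊗[k] H) ∘ₗ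
    Coalgebra.comul

/-- The element `Q_J = S(J⁽¹⁾) J⁽²⁾`. -/
def Q (J : HopfTwist k H) : H :=
  LinearMap.mul' k H (LinearMap.rTensor H (HopfAlgebra.antipode k) (J.elt : H ⊗[k] H))

/-- The element `J⁻⁽¹⁾ S(J⁻⁽²⁾)`, which is inverse to `Q_J`. -/
def Qinv (J : HopfTwist k H) : H :=
  LinearMap.mul' k H (LinearMap.lTensor H (HopfAlgebra.antipode k) (↑J.elt⁻¹ : H ⊗[k] H))

/-- The twisted antipode `S^J(h) = Q_J⁻¹ S(h) Q_J`. -/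
def antipode (J : HopfTwist k H) : H →ₗ[k] H :=
  LinearMap.mulLeft k J.Qinv ∘ₗ LinearMap.mulRight k J.Q ∘ₗ HopfAlgebra.antipode k

theorem comul_apply (J : HopfTwist k H) (h : H) :
    J.comul h = (↑J.elt⁻¹ : H ⊗[k] H) * (Coalgebra.comul (R := k) h * (J.elt : H ⊗[k] H)) := rfl

theorem antipode_apply (J : HopfTwist k H) (h : H) :
    J.antipode h = J.Qinv * (HopfAlgebra.antipode k h * J.Q) := rfl

/-! ### `H^J` is a Hopf algebra -/

/-- `Δ ⊗ id` -/
def f1 : H ⊗[k] H →ₐ[k] H ⊗[k] (H ⊗[k] H) :=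
  (Algebra.TensorProduct.assoc k k k H H H).toAlgHom.comp
    (Algebra.TensorProduct.map (Bialgebra.comulAlgHom k H) (AlgHom.id k H))

/-- `id ⊗ Δ` -/
def f2 : H ⊗[k] H →ₐ[k] H ⊗[k] (H ⊗[k] H) :=
  Algebra.TensorProduct.map (AlgHom.id k H) (Bialgebra.comulAlgHom k H)

/-- `X ↦ X ⊗ 1` -/
def i1 : H ⊗[k] H →ₐ[k] H ⊗[k] (H ⊗[k] H) :=
  (Algebra.TensorProduct.assoc k k k H H H).toAlgHom.comp
    (Algebra.TensorProduct.includeLeft (R := k) (S := k) (A := H ⊗[k] H) (B := H))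

/-- `X ↦ 1 ⊗ X` -/
def i2 : H ⊗[k] H →ₐ[k] H ⊗[k] (H ⊗[k] H) :=
  Algebra.TensorProduct.includeRight

/-- `id ⊗ ε` -/
def eR : H ⊗[k] H →ₐ[k] H :=
  (Algebra.TensorProduct.rid k k H).toAlgHom.comp
    (Algebra.TensorProduct.map (AlgHom.id k H) (Bialgebra.counitAlgHom k H))

/-- `ε ⊗ id` -/
def eL : H ⊗[k] H →ₐ[k] H :=
  (Algebra.TensorProduct.lid k H).toAlgHom.comp
    (Algebra.TensorProduct.map (Bialgebra.counitAlgHom k H) (AlgHom.id k H))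

theorem eR_tmul (a b : H) : eR (a ⊗ₜ[k] b) = Coalgebra.counit (R := k) b • a := by
  simp [eR]

theorem eL_tmul (a b : H) : eL (a ⊗ₜ[k] b) = Coalgebra.counit (R := k) a • b := by
  simp [eL]

theorem eR_comul (h : H) : eR (Coalgebra.comul (R := k) h) = h := by
  have h2 := congrArg (TensorProduct.rid k H) (Coalgebra.lTensor_counit_comul (R := k) h)
  rw [TensorProduct.rid_tmul, one_smul] at h2
  exact h2

theorem eL_comul (h : H) : eL (Coalgebra.comul (R := k) h) = h := by
  have h2 := congrArg (TensorProduct.lid k H) (Coalgebra.rTensor_counit_comul (R := k) h)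
  rw [TensorProduct.lid_tmul, one_smul] at h2
  exact h2

theorem twist_eq' (J : HopfTwist k H) :
    f1 (J.elt : H ⊗[k] H) * i1 (J.elt : H ⊗[k] H) =
      f2 (J.elt : H ⊗[k] H) * i2 (J.elt : H ⊗[k] H) := by
  have := J.twist_eq
  rw [map_mul] at this
  exact this

theorem twist_eq_units (J : HopfTwist k H) :
    Units.map (f1 (k := k) (H := H)).toMonoidHom J.elt *
        Units.map (i1 (k := k) (H := H)).toMonoidHom J.elt =
      Units.map (f2 (k := k) (H := H)).toMonoidHom J.elt *
        Units.map (i2 (k := k) (H := H)).toMonoidHom J.elt :=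
  Units.ext J.twist_eq'

theorem twist_eq_inv (J : HopfTwist k H) :
    i1 (↑J.elt⁻¹ : H ⊗[k] H) * f1 (↑J.elt⁻¹ : H ⊗[k] H) =
      i2 (↑J.elt⁻¹ : H ⊗[k] H) * f2 (↑J.elt⁻¹ : H ⊗[k] H) := by
  have := congrArg (fun u : (H ⊗[k] (H ⊗[k] H))ˣ => (↑u⁻¹ : H ⊗[k] (H ⊗[k] H))) J.twist_eq_units
  simp only [mul_inv_rev, Units.val_mul] at this
  exact this

theorem twist_eq_mixed (J : HopfTwist k H) :
    f2 (↑J.elt⁻¹ : H ⊗[k] H) * f1 (J.elt : H ⊗[k] H) =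
      i2 (J.elt : H ⊗[k] H) * i1 (↑J.elt⁻¹ : H ⊗[k] H) := by
  have h1 : f2 (↑J.elt⁻¹ : H ⊗[k] H) * f2 (J.elt : H ⊗[k] H) = 1 := by
    rw [← map_mul, Units.inv_mul, map_one]
  have h2 : i1 (J.elt : H ⊗[k] H) * i1 (↑J.elt⁻¹ : H ⊗[k] H) = 1 := by
    rw [← map_mul, Units.mul_inv, map_one]
  calc _ = f2 (↑J.elt⁻¹ : H ⊗[k] H) * (f1 (J.elt : H ⊗[k] H) * i1 (J.elt : H ⊗[k] H)) *
        i1 (↑J.elt⁻¹ : H ⊗[k] H) := by rw [mul_assoc, mul_assoc, h2, mul_one]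
    _ = _ := by rw [J.twist_eq', ← mul_assoc, h1, one_mul]

/-- `id ⊗ ε ⊗ id` -/
def eM : H ⊗[k] (H ⊗[k] H) →ₐ[k] H ⊗[k] H :=
  Algebra.TensorProduct.map (AlgHom.id k H) eL

theorem eM_f1 (X : H ⊗[k] H) : eM (f1 X) = X := by
  induction X with
  | zero => simp
  | add x y hx hy => simp [hx, hy]
  | tmul a b =>
    have : ∀ Y : H ⊗[k] H, eM (Algebra.TensorProduct.assoc k k k H H H (Y ⊗ₜ[k] b)) =
        eR Y ⊗ₜ[k] b := by
      intro Y
      induction Y with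
      | zero => simp
      | add x y hx hy => simp [hx, hy, TensorProduct.add_tmul]
      | tmul c d => simp [eM, eR_tmul, eL_tmul, TensorProduct.smul_tmul]
    have h2 := this (Coalgebra.comul (R := k) a)
    rw [eR_comul] at h2
    simpa [f1] using h2

theorem eM_f2 (X : H ⊗[k] H) : eM (f2 X) = X := by
  induction X with
  | zero => simp
  | add x y hx hy => simp [hx, hy]
  | tmul a b => simp [eM, f2, eL_comul]

theorem eM_i1 (X : H ⊗[k] H) : eM (i1 X) = eR X ⊗ₜ[k] (1 : H) := by
  induction X with
  | zero => simp
  | add x y hx hy => simp [hx, hy, TensorProduct.add_tmul]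
  | tmul a b => simp [eM, i1, eL_tmul, eR_tmul, TensorProduct.smul_tmul]

theorem eM_i2 (X : H ⊗[k] H) : eM (i2 X) = (1 : H) ⊗ₜ[k] eL X := by
  simp [eM, i2]

theorem eR_tmul_one (J : HopfTwist k H) :
    eR (J.elt : H ⊗[k] H) ⊗ₜ[k] (1 : H) = (1 : H) ⊗ₜ[k] eL (J.elt : H ⊗[k] H) := by
  have := congr(eM $(J.twist_eq'))
  rw [map_mul, map_mul, eM_f1, eM_f2, eM_i1, eM_i2] at this
  exact (Units.mul_right_inj _).1 this

/-- `(ε ⊗ id)(J)` and `(id ⊗ ε)(J)` are one and the same scalar. -/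
theorem exists_scalar (J : HopfTwist k H) :
    ∃ c : k, eL (J.elt : H ⊗[k] H) = algebraMap k H c ∧
      eR (J.elt : H ⊗[k] H) = algebraMap k H c := by
  have h1 := congr(eL $(J.eR_tmul_one))
  have h2 := congr(eR $(J.eR_tmul_one))
  simp only [eL_tmul, eR_tmul, Bialgebra.counit_one, one_smul] at h1 h2
  refine ⟨Coalgebra.counit (R := k) (eR (J.elt : H ⊗[k] H)), ?_, ?_⟩
  · rw [← h1, Algebra.algebraMap_eq_smul_one]
  · have h3 := congr(Coalgebra.counit (R := k) $h1)
    simp only [map_smul, Bialgebra.counit_one, smul_eq_mul, mul_one] at h3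
    rw [h3, Algebra.algebraMap_eq_smul_one]
    exact h2

theorem eL_inv_mul (J : HopfTwist k H) :
    eL (↑J.elt⁻¹ : H ⊗[k] H) * eL (J.elt : H ⊗[k] H) = 1 := by
  rw [← map_mul, Units.inv_mul, map_one]

theorem eR_inv_mul (J : HopfTwist k H) :
    eR (↑J.elt⁻¹ : H ⊗[k] H) * eR (J.elt : H ⊗[k] H) = 1 := by
  rw [← map_mul, Units.inv_mul, map_one]

theorem eL_twist_comul (J : HopfTwist k H) (h : H) : eL (J.comul h) = h := by
  obtain ⟨c, hL, -⟩ := J.exists_scalar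
  have h1 := J.eL_inv_mul
  rw [comul_apply, map_mul, map_mul, eL_comul, hL, ← Algebra.commutes, ← mul_assoc, ← hL, h1,
    one_mul]

theorem eR_twist_comul (J : HopfTwist k H) (h : H) : eR (J.comul h) = h := by
  obtain ⟨c, -, hR⟩ := J.exists_scalar
  have h1 := J.eR_inv_mul
  rw [comul_apply, map_mul, map_mul, eR_comul, hR, ← Algebra.commutes, ← mul_assoc, ← hR, h1,
    one_mul]

theorem assoc_rTensor_comul (J : HopfTwist k H) (X : H ⊗[k] H) :
    TensorProduct.assoc k H H H (J.comul.rTensor H X) =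
      i1 (↑J.elt⁻¹ : H ⊗[k] H) * (f1 X * i1 (J.elt : H ⊗[k] H)) := by
  induction X with
  | zero => simp
  | add x y hx hy => simp [hx, hy, mul_add, add_mul]
  | tmul a b =>
    have : J.comul.rTensor H (a ⊗ₜ[k] b) = ((↑J.elt⁻¹ : H ⊗[k] H) ⊗ₜ[k] (1 : H)) *
        ((Coalgebra.comul (R := k) a ⊗ₜ[k] b) * ((J.elt : H ⊗[k] H) ⊗ₜ[k] (1 : H))) := by
      simp [comul_apply]
    rw [this]
    exact (map_mul (Algebra.TensorProduct.assoc k k k H H H) _ _).trans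
      (congrArg _ (map_mul (Algebra.TensorProduct.assoc k k k H H H) _ _))

theorem lTensor_comul (J : HopfTwist k H) (X : H ⊗[k] H) :
    J.comul.lTensor H X = i2 (↑J.elt⁻¹ : H ⊗[k] H) * (f2 X * i2 (J.elt : H ⊗[k] H)) := by
  induction X with
  | zero => simp
  | add x y hx hy => simp [hx, hy, mul_add, add_mul]
  | tmul a b => simp [comul_apply, i2, f2]

theorem f1_comul (h : H) :
    f1 (Coalgebra.comul (R := k) h) = f2 (Coalgebra.comul (R := k) h) :=
  Coalgebra.coassoc_apply (R := k) h

/-- The twisted coalgebra structure: comultiplication `Δ^J`, counit `ε`. -/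
abbrev coalgebra (J : HopfTwist k H) : Coalgebra k H where
  comul := J.comul
  counit := Coalgebra.counit
  coassoc := by
    ext h
    simp only [LinearMap.coe_comp, LinearEquiv.coe_coe, Function.comp_apply]
    rw [assoc_rTensor_comul, lTensor_comul, comul_apply]
    simp only [map_mul, f1_comul]
    calc _ = (i1 (↑J.elt⁻¹ : H ⊗[k] H) * f1 (↑J.elt⁻¹ : H ⊗[k] H)) *
          f2 (Coalgebra.comul (R := k) h) *
          (f1 (J.elt : H ⊗[k] H) * i1 (J.elt : H ⊗[k] H)) := by simp only [mul_assoc]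
      _ = _ := by rw [J.twist_eq_inv, J.twist_eq']; simp only [mul_assoc]
  rTensor_counit_comp_comul := by
    ext h
    apply (TensorProduct.lid k H).injective
    refine (J.eL_twist_comul h).trans ?_
    simp
  lTensor_counit_comp_comul := by
    ext h
    apply (TensorProduct.rid k H).injective
    refine (J.eR_twist_comul h).trans ?_
    simp

/-- The twisted bialgebra structure, with the algebra structure of `H`. -/
abbrev bialgebra (J : HopfTwist k H) : Bialgebra k H where
  __ := J.coalgebra
  counit_one := Bialgebra.counit_one
  mul_compr₂_counit := Bialgebra.mul_compr₂_counit
  comul_one := by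
    change J.comul 1 = 1
    rw [comul_apply, Bialgebra.comul_one, one_mul, Units.inv_mul]
  mul_compr₂_comul := by
    ext a b
    change J.comul (a * b) = J.comul a * J.comul b
    simp only [comul_apply, Bialgebra.comul_mul, mul_assoc, Units.mul_inv_cancel_left]

/-- `X ↦ S(X⁽¹⁾) w X⁽²⁾` -/
def F (w : H) : H ⊗[k] H →ₗ[k] H :=
  LinearMap.mul' k H ∘ₗ
    TensorProduct.map (LinearMap.mulRight k w ∘ₗ HopfAlgebra.antipode k) LinearMap.id

/-- `X ↦ X⁽¹⁾ w S(X⁽²⁾)` -/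
def G (w : H) : H ⊗[k] H →ₗ[k] H :=
  LinearMap.mul' k H ∘ₗ
    TensorProduct.map LinearMap.id (LinearMap.mulLeft k w ∘ₗ HopfAlgebra.antipode k)

theorem F_tmul (w a b : H) : F w (a ⊗ₜ[k] b) = HopfAlgebra.antipode k a * w * b := by
  simp [F]

theorem G_tmul (w a b : H) : G w (a ⊗ₜ[k] b) = a * w * HopfAlgebra.antipode k b := by
  simp [G, mul_assoc]

theorem F_add (w v : H) (X : H ⊗[k] H) : F (w + v) X = F w X + F v X := by
  induction X with
  | zero => simp
  | add x y hx hy => simp only [map_add, hx, hy]; abel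
  | tmul a b => simp [F_tmul, mul_add, add_mul]

theorem G_add (w v : H) (X : H ⊗[k] H) : G (w + v) X = G w X + G v X := by
  induction X with
  | zero => simp
  | add x y hx hy => simp only [map_add, hx, hy]; abel
  | tmul a b => simp [G_tmul, mul_add, add_mul]

theorem F_zero (X : H ⊗[k] H) : F 0 X = 0 := by simpa using F_add 0 0 X

theorem G_zero (X : H ⊗[k] H) : G 0 X = 0 := by simpa using G_add 0 0 X

theorem F_algebraMap (c : k) (X : H ⊗[k] H) : F (algebraMap k H c) X = c • F 1 X := by
  induction X with
  | zero => simp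
  | add x y hx hy => simp [hx, hy]
  | tmul a b => simp [F_tmul, Algebra.algebraMap_eq_smul_one]

theorem G_algebraMap (c : k) (X : H ⊗[k] H) : G (algebraMap k H c) X = c • G 1 X := by
  induction X with
  | zero => simp
  | add x y hx hy => simp [hx, hy]
  | tmul a b => simp [G_tmul, Algebra.algebraMap_eq_smul_one]

theorem F_mul (w : H) (X Y : H ⊗[k] H) : F w (X * Y) = F (F w X) Y := by
  induction X with
  | zero => simp [F_zero]
  | add x y hx hy => simp [add_mul, hx, hy, F_add]
  | tmul a b =>
    induction Y with
    | zero => simp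
    | add x y hx hy => simp [mul_add, hx, hy]
    | tmul c d => simp [F_tmul, HopfAlgebra.antipode_mul_antidistrib, mul_assoc]

theorem G_mul (w : H) (X Y : H ⊗[k] H) : G w (X * Y) = G (G w Y) X := by
  induction Y with
  | zero => simp [G_zero]
  | add x y hx hy => simp [mul_add, hx, hy, G_add]
  | tmul a b =>
    induction X with
    | zero => simp
    | add x y hx hy => simp [add_mul, hx, hy]
    | tmul c d => simp [G_tmul, HopfAlgebra.antipode_mul_antidistrib, mul_assoc]

theorem F_one_eq (X : H ⊗[k] H) :
    F 1 X = LinearMap.mul' k H (LinearMap.rTensor H (HopfAlgebra.antipode k) X) := by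
  induction X with
  | zero => simp
  | add x y hx hy => simp only [map_add, hx, hy]
  | tmul a b => simp [F_tmul]

theorem G_one_eq (X : H ⊗[k] H) :
    G 1 X = LinearMap.mul' k H (LinearMap.lTensor H (HopfAlgebra.antipode k) X) := by
  induction X with
  | zero => simp
  | add x y hx hy => simp only [map_add, hx, hy]
  | tmul a b => simp [G_tmul]

theorem F_one_comul (h : H) : F 1 (Coalgebra.comul (R := k) h) =
    algebraMap k H (Coalgebra.counit h) := by
  rw [F_one_eq, HopfAlgebra.mul_antipode_rTensor_comul_apply]

theorem G_one_comul (h : H) : G 1 (Coalgebra.comul (R := k) h) =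
    algebraMap k H (Coalgebra.counit h) := by
  rw [G_one_eq, HopfAlgebra.mul_antipode_lTensor_comul_apply]

theorem F_one_elt (J : HopfTwist k H) : F 1 (J.elt : H ⊗[k] H) = J.Q := F_one_eq _

theorem G_one_elt (J : HopfTwist k H) : G 1 (↑J.elt⁻¹ : H ⊗[k] H) = J.Qinv := G_one_eq _

/-- `x ⊗ y ⊗ z ↦ x S(y) z` -/
def P : H ⊗[k] (H ⊗[k] H) →ₗ[k] H :=
  LinearMap.mul' k H ∘ₗ LinearMap.lTensor H (F 1)

theorem P_tmul (a : H) (X : H ⊗[k] H) : P (a ⊗ₜ[k] X) = a * F 1 X := by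
  simp [P]

theorem P_i2_i1 (U V : H ⊗[k] H) : P (i2 U * i1 V) = G 1 V * F 1 U := by
  induction U with
  | zero => simp
  | add x y hx hy => simp [add_mul, mul_add, hx, hy]
  | tmul a b =>
    induction V with
    | zero => simp
    | add x y hx hy => simp [add_mul, mul_add, hx, hy]
    | tmul c d =>
      simp [i1, i2, P_tmul, F_tmul, G_tmul, HopfAlgebra.antipode_mul_antidistrib, mul_assoc]

theorem P_f2_f1 (V U : H ⊗[k] H) : P (f2 V * f1 U) = eR V * eL U := by
  induction U with
  | zero => simp
  | add x y hx hy => simp [mul_add, hx, hy]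
  | tmul c d =>
    induction V with
    | zero => simp
    | add x y hx hy => simp [add_mul, hx, hy]
    | tmul a b =>
      have key : ∀ Y : H ⊗[k] H,
          P ((a ⊗ₜ[k] Coalgebra.comul (R := k) b) *
            Algebra.TensorProduct.assoc k k k H H H (Y ⊗ₜ[k] d)) =
          Coalgebra.counit (R := k) b • (a * G 1 Y * d) := by
        intro Y
        induction Y with
        | zero => simp
        | add x y hx hy =>
          simp only [TensorProduct.add_tmul, map_add, mul_add, hx, hy, add_mul, smul_add]
        | tmul x y =>
          simp [P_tmul, F_mul, F_one_comul, F_tmul, G_tmul, mul_assoc,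
            Algebra.algebraMap_eq_smul_one]
      have := key (Coalgebra.comul (R := k) c)
      rw [G_one_comul] at this
      simp only [f1, f2, eR_tmul, eL_tmul]
      refine (Eq.trans ?_ this).trans ?_
      · simp
      · simp [Algebra.algebraMap_eq_smul_one, smul_smul, mul_comm]

theorem Qinv_mul_Q (J : HopfTwist k H) : J.Qinv * J.Q = 1 := by
  rw [← F_one_elt, ← G_one_elt, ← P_i2_i1, ← twist_eq_mixed, P_f2_f1]
  obtain ⟨c, hL, hR⟩ := J.exists_scalar
  rw [hL, ← hR, eR_inv_mul]

theorem F_Q (J : HopfTwist k H) : F J.Q (↑J.elt⁻¹ : H ⊗[k] H) = 1 := by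
  rw [← F_one_elt, ← F_mul, Units.mul_inv]
  simp [Algebra.TensorProduct.one_def, F_tmul]

theorem G_Qinv (J : HopfTwist k H) : G J.Qinv (J.elt : H ⊗[k] H) = 1 := by
  rw [← G_one_elt, ← G_mul, Units.mul_inv]
  simp [Algebra.TensorProduct.one_def, G_tmul]

/-- The Hopf algebra structure `H^J`: the algebra structure and counit of `H`, the
comultiplication `Δ^J` and the antipode `S^J`. -/
abbrev hopfAlgebra (J : HopfTwist k H) : HopfAlgebra k H where
  __ := J.bialgebra
  antipode := J.antipode
  mul_antipode_rTensor_comul := by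
    ext h
    have h1 : ∀ X : H ⊗[k] H,
        LinearMap.mul' k H (J.antipode.rTensor H X) = J.Qinv * F J.Q X := by
      intro X
      induction X with
      | zero => simp
      | add x y hx hy => simp only [map_add, hx, hy, mul_add]
      | tmul a b => simp [F_tmul, antipode_apply, mul_assoc]
    change LinearMap.mul' k H (J.antipode.rTensor H (J.comul h)) =
      algebraMap k H (Coalgebra.counit (R := k) h)
    rw [h1, comul_apply, F_mul, F_Q, F_mul, F_one_comul, F_algebraMap, F_one_elt, mul_smul_comm,
      Qinv_mul_Q, Algebra.algebraMap_eq_smul_one]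
    rfl
  mul_antipode_lTensor_comul := by
    ext h
    have h1 : ∀ X : H ⊗[k] H,
        LinearMap.mul' k H (J.antipode.lTensor H X) = G J.Qinv X * J.Q := by
      intro X
      induction X with
      | zero => simp
      | add x y hx hy => simp only [map_add, hx, hy, add_mul]
      | tmul a b => simp [G_tmul, antipode_apply, mul_assoc]
    change LinearMap.mul' k H (J.antipode.lTensor H (J.comul h)) =
      algebraMap k H (Coalgebra.counit (R := k) h)
    rw [h1, comul_apply, G_mul, G_mul, G_Qinv, G_one_comul, G_algebraMap, G_one_elt,
      smul_mul_assoc, Qinv_mul_Q, Algebra.algebraMap_eq_smul_one]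
    rfl

/-- The underlying type of the twisted Hopf algebra `H^J`: a copy of `H`. -/
@[nolint unusedArguments]
def Twisted {k H : Type*} [Field k] [Ring H] [HopfAlgebra k H] (_J : HopfTwist k H) : Type _ := H

instance (J : HopfTwist k H) : Ring J.Twisted := inferInstanceAs (Ring H)

instance (J : HopfTwist k H) : HopfAlgebra k J.Twisted := J.hopfAlgebra

end HopfTwist

end

/-! Twisting changes neither the algebra nor the counit, so unimodularity is immediate; the content
is cosemisimplicity. By a dual Maschke argument (`isCoseparabilityForm_of_integral`,
`IsCoseparabilityForm.isCosemisimple`) it suffices to find a functional `l'` with `l'(1) = 1` that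
is left invariant for `Δ^J`. Cosemisimplicity of `H` gives a normalized two-sided integral `l`, and
unimodularity makes `S²` its Nakayama automorphism: `l(xa) = l(S²(a)x)` (`integral_mul_comm`). The
functional sought is `l' = l(u ·)` with `u = S(Q_J⁻¹)Q_J`. The bridge from `Δ` to `Δ^J` is the
coalgebra with comultiplication `h ↦ Δ(h)J`. As `k` is algebraically closed, it contains a matrix
coalgebra, that is, a matrix `X` over `H` with `Δ(X_ij)J = ∑ X_il ⊗ X_lj`. This `X` has an inverse
`Y`, and `Δ(X_pa h Y_bq)` is a sum of terms with `Δ^J(h)` in the middle (`comul_mul_mul`).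
Invariance of `l` under `Δ` thus becomes a system of equations for the functionals `l(X_pa · Y_bq)`
under `Δ^J`. A Schur argument gives `l(X_pa Y_bq) = δ_pq f_ab` with `f` invertible of trace 1.
Weighting the functionals by `f_pq` and moving `Y_bq` to the front through `S²` collapses them to
`f_ab l'` (`sum_smul_sandwich`). The weighted system is then the invariance of `l'`, and its value
at 1 gives `l'(1) = 1`. -/

noncomputable section

namespace CoalgebraTwist

/-! ### The two commuting actions of the dual on a coalgebra -/

section Translations

variable {k C : Type*} [Field k] [AddCommGroup C] [Module k C] [Coalgebra k C]

/-- Right translation `h ↦ h₁ φ(h₂)`. -/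
def rTrans (φ : C →ₗ[k] k) : C →ₗ[k] C :=
  (TensorProduct.rid k C).toLinearMap ∘ₗ φ.lTensor C ∘ₗ Coalgebra.comul

/-- Left translation `h ↦ φ(h₁) h₂`. -/
def lTrans (φ : C →ₗ[k] k) : C →ₗ[k] C :=
  (TensorProduct.lid k C).toLinearMap ∘ₗ φ.rTensor C ∘ₗ Coalgebra.comul

theorem rTrans_apply (φ : C →ₗ[k] k) (h : C) :
    rTrans φ h = TensorProduct.rid k C (φ.lTensor C (Coalgebra.comul h)) := rfl

theorem lTrans_apply (φ : C →ₗ[k] k) (h : C) :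
    lTrans φ h = TensorProduct.lid k C (φ.rTensor C (Coalgebra.comul h)) := rfl

/-- The convolution product of functionals. -/
def conv (φ ψ : C →ₗ[k] k) : C →ₗ[k] k :=
  LinearMap.mul' k k ∘ₗ TensorProduct.map φ ψ ∘ₗ Coalgebra.comul

theorem comul_rTrans (φ : C →ₗ[k] k) (h : C) :
    Coalgebra.comul (R := k) (rTrans φ h) = (rTrans φ).lTensor C (Coalgebra.comul h) := by
  have h1 : ∀ X : C ⊗[k] C, Coalgebra.comul (R := k) (TensorProduct.rid k C (φ.lTensor C X)) =
      ((TensorProduct.rid k C).toLinearMap ∘ₗ φ.lTensor C).lTensor C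
        (TensorProduct.assoc k C C C (Coalgebra.comul.rTensor C X)) := by
    intro X
    induction X with
    | zero => simp
    | add x y hx hy => simp only [map_add, hx, hy]
    | tmul a b =>
      have : ∀ Y : C ⊗[k] C, φ b • Y =
          ((TensorProduct.rid k C).toLinearMap ∘ₗ φ.lTensor C).lTensor C
            (TensorProduct.assoc k C C C (Y ⊗ₜ b)) := by
        intro Y
        induction Y with
        | zero => simp
        | add x y hx hy => simp only [map_add, smul_add, hx, hy, TensorProduct.add_tmul]
        | tmul x y => simp
      simpa using this (Coalgebra.comul a)
  rw [rTrans_apply, h1, Coalgebra.coassoc_apply, ← LinearMap.comp_apply, ← LinearMap.lTensor_comp]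
  rfl

theorem comul_lTrans (φ : C →ₗ[k] k) (h : C) :
    Coalgebra.comul (R := k) (lTrans φ h) = (lTrans φ).rTensor C (Coalgebra.comul h) := by
  have h1 : ∀ X : C ⊗[k] C, Coalgebra.comul (R := k) (TensorProduct.lid k C (φ.rTensor C X)) =
      ((TensorProduct.lid k C).toLinearMap ∘ₗ φ.rTensor C).rTensor C
        ((TensorProduct.assoc k C C C).symm (Coalgebra.comul.lTensor C X)) := by
    intro X
    induction X with
    | zero => simp
    | add x y hx hy => simp only [map_add, hx, hy]
    | tmul b a =>
      have : ∀ Y : C ⊗[k] C, φ b • Y =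
          ((TensorProduct.lid k C).toLinearMap ∘ₗ φ.rTensor C).rTensor C
            ((TensorProduct.assoc k C C C).symm (b ⊗ₜ Y)) := by
        intro Y
        induction Y with
        | zero => simp
        | add x y hx hy => simp only [map_add, smul_add, hx, hy, TensorProduct.tmul_add]
        | tmul x y => simp [TensorProduct.smul_tmul']
      simpa using this (Coalgebra.comul a)
  rw [lTrans_apply, h1, Coalgebra.coassoc_symm_apply, ← LinearMap.comp_apply,
    ← LinearMap.rTensor_comp]
  rfl

theorem rTrans_rTrans (χ φ : C →ₗ[k] k) (h : C) :
    rTrans χ (rTrans φ h) = rTrans (conv χ φ) h := by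
  have h2 : χ ∘ₗ rTrans φ = conv χ φ := by
    ext x
    have : ∀ X : C ⊗[k] C, χ (TensorProduct.rid k C (φ.lTensor C X)) =
        LinearMap.mul' k k (TensorProduct.map χ φ X) := by
      intro X
      induction X with
      | zero => simp
      | add x y hx hy => simp only [map_add, hx, hy]
      | tmul a b => simp [mul_comm]
    exact this _
  rw [rTrans_apply, comul_rTrans, ← LinearMap.comp_apply, ← LinearMap.lTensor_comp, h2]
  rfl

theorem counit_rTrans (φ : C →ₗ[k] k) (h : C) :
    Coalgebra.counit (R := k) (rTrans φ h) = φ h := by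
  have : ∀ X : C ⊗[k] C, Coalgebra.counit (R := k) (TensorProduct.rid k C (φ.lTensor C X)) =
      φ (TensorProduct.lid k C (Coalgebra.counit.rTensor C X)) := by
    intro X
    induction X with
    | zero => simp
    | add x y hx hy => simp only [map_add, hx, hy]
    | tmul a b => simp [mul_comm]
  rw [rTrans_apply, this, Coalgebra.rTensor_counit_comul]
  simp

theorem rTrans_lTrans (χ φ : C →ₗ[k] k) (h : C) :
    rTrans χ (lTrans φ h) = lTrans φ (rTrans χ h) := by
  have h1 : ∀ X : C ⊗[k] C, TensorProduct.rid k C (χ.lTensor C ((lTrans φ).rTensor C X)) =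
      lTrans φ (TensorProduct.rid k C (χ.lTensor C X)) := by
    intro X
    induction X with
    | zero => simp
    | add x y hx hy => simp only [map_add, hx, hy]
    | tmul a b => simp
  rw [rTrans_apply, comul_lTrans, h1]
  rfl

end Translations

section Tensors

variable {k C : Type*} [Field k] [AddCommGroup C] [Module k C]

theorem sum_rid_lTensor_tmul {M ι : Type*} [AddCommGroup M] [Module k M] [Fintype ι]
    (b : Module.Basis ι k C) (X : M ⊗[k] C) :
    ∑ i, TensorProduct.rid k M ((b.coord i).lTensor M X) ⊗ₜ[k] b i = X := by
  induction X with
  | zero => simp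
  | add x y hx hy =>
    conv_rhs => rw [← hx, ← hy]
    simp only [map_add, TensorProduct.add_tmul, Finset.sum_add_distrib]
  | tmul m c =>
    simp only [LinearMap.lTensor_tmul, TensorProduct.rid_tmul, TensorProduct.smul_tmul,
      Module.Basis.coord_apply, ← TensorProduct.tmul_sum, b.sum_repr]

theorem sum_tmul_lid_rTensor {M ι : Type*} [AddCommGroup M] [Module k M] [Fintype ι]
    (b : Module.Basis ι k C) (X : C ⊗[k] M) :
    ∑ i, b i ⊗ₜ[k] TensorProduct.lid k M ((b.coord i).rTensor M X) = X := by
  induction X with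
  | zero => simp
  | add x y hx hy =>
    conv_rhs => rw [← hx, ← hy]
    simp only [map_add, TensorProduct.tmul_add, Finset.sum_add_distrib]
  | tmul c m =>
    simp only [LinearMap.rTensor_tmul, TensorProduct.lid_tmul, ← TensorProduct.smul_tmul,
      Module.Basis.coord_apply, ← TensorProduct.sum_tmul, b.sum_repr]

theorem exists_leftInverse_subtype (D : Submodule k C) :
    ∃ p : C →ₗ[k] D, ∀ d ∈ D, (D.subtype ∘ₗ p) d = d := by
  obtain ⟨p, hp⟩ := D.subtype.exists_leftInverse_of_injective D.ker_subtype
  exact ⟨p, fun d hd ↦ congrArg D.subtype (LinearMap.congr_fun hp ⟨d, hd⟩)⟩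

end Tensors

/-! ### Coideals, subcoalgebras, and cosemisimplicity from a coseparability form -/

section Subcoalgebras

variable {k C : Type*} [Field k] [AddCommGroup C] [Module k C] [Coalgebra k C]

/-- A right coideal: a subspace stable under all right translations. -/
def IsRightCoideal (K : Submodule k C) : Prop :=
  ∀ (φ : C →ₗ[k] k), ∀ x ∈ K, rTrans φ x ∈ K

/-- A left coideal: a subspace stable under all left translations. -/
def IsLeftCoideal (K : Submodule k C) : Prop :=
  ∀ (φ : C →ₗ[k] k), ∀ x ∈ K, lTrans φ x ∈ K

theorem isRightCoideal_of_isSubcoalgebra {D : Submodule k C} (hD : IsSubcoalgebra k D) :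
    IsRightCoideal D := by
  intro φ x hx
  obtain ⟨X, hX⟩ := hD x hx
  rw [rTrans_apply, ← hX]
  clear hX
  induction X with
  | zero => simp
  | add x y hx hy => simp only [map_add]; exact D.add_mem hx hy
  | tmul a b => simpa [TensorProduct.mapIncl] using D.smul_mem _ a.2

theorem isLeftCoideal_of_isSubcoalgebra {D : Submodule k C} (hD : IsSubcoalgebra k D) :
    IsLeftCoideal D := by
  intro φ x hx
  obtain ⟨X, hX⟩ := hD x hx
  rw [lTrans_apply, ← hX]
  clear hX
  induction X with
  | zero => simp
  | add x y hx hy => simp only [map_add]; exact D.add_mem hx hy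
  | tmul a b => simpa [TensorProduct.mapIncl] using D.smul_mem _ b.2

theorem rTrans_eq_zero {D : Submodule k C} (hD : IsSubcoalgebra k D) {φ : C →ₗ[k] k}
    (hφ : ∀ x ∈ D, φ x = 0) {x : C} (hx : x ∈ D) : rTrans φ x = 0 := by
  obtain ⟨X, hX⟩ := hD x hx
  rw [rTrans_apply, ← hX]
  clear hX
  induction X with
  | zero => simp
  | add x y hx hy => simp only [map_add, hx, hy, add_zero]
  | tmul a b => simp [TensorProduct.mapIncl, hφ]

theorem lTrans_eq_zero {D : Submodule k C} (hD : IsSubcoalgebra k D) {φ : C →ₗ[k] k}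
    (hφ : ∀ x ∈ D, φ x = 0) {x : C} (hx : x ∈ D) : lTrans φ x = 0 := by
  obtain ⟨X, hX⟩ := hD x hx
  rw [lTrans_apply, ← hX]
  clear hX
  induction X with
  | zero => simp
  | add x y hx hy => simp only [map_add, hx, hy, add_zero]
  | tmul a b => simp [TensorProduct.mapIncl, hφ]

theorem conv_eq_zero {D : Submodule k C} (hD : IsSubcoalgebra k D) {φ ψ : C →ₗ[k] k}
    (h : (∀ x ∈ D, φ x = 0) ∨ ∀ x ∈ D, ψ x = 0) {x : C} (hx : x ∈ D) : conv φ ψ x = 0 := by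
  obtain ⟨X, hX⟩ := hD x hx
  rw [conv, LinearMap.comp_apply, LinearMap.comp_apply, ← hX]
  clear hX
  induction X with
  | zero => simp
  | add x y hx hy => simp only [map_add, hx, hy, add_zero]
  | tmul a b => rcases h with h | h <;> simp [TensorProduct.mapIncl, h]

theorem IsRightCoideal.rTensor_comul [FiniteDimensional k C] {D : Submodule k C}
    (hD : IsRightCoideal D) {p : C →ₗ[k] C} (hp : ∀ d ∈ D, p d = d) {x : C} (hx : x ∈ D) :
    p.rTensor C (Coalgebra.comul x) = Coalgebra.comul (R := k) x := by
  let b := Module.finBasis k C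
  conv_rhs => rw [← sum_rid_lTensor_tmul b (Coalgebra.comul x)]
  conv_lhs => rw [← sum_rid_lTensor_tmul b (Coalgebra.comul x)]
  rw [map_sum]
  refine Finset.sum_congr rfl fun i _ ↦ ?_
  rw [LinearMap.rTensor_tmul]
  exact congrArg (· ⊗ₜ[k] b i) (hp _ (hD (b.coord i) x hx))

theorem IsLeftCoideal.lTensor_comul [FiniteDimensional k C] {D : Submodule k C}
    (hD : IsLeftCoideal D) {p : C →ₗ[k] C} (hp : ∀ d ∈ D, p d = d) {x : C} (hx : x ∈ D) :
    p.lTensor C (Coalgebra.comul x) = Coalgebra.comul (R := k) x := by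
  let b := Module.finBasis k C
  conv_rhs => rw [← sum_tmul_lid_rTensor b (Coalgebra.comul x)]
  conv_lhs => rw [← sum_tmul_lid_rTensor b (Coalgebra.comul x)]
  rw [map_sum]
  refine Finset.sum_congr rfl fun i _ ↦ ?_
  rw [LinearMap.lTensor_tmul]
  exact congrArg (b i ⊗ₜ[k] ·) (hp _ (hD (b.coord i) x hx))

/-- A linear projection `p` onto `D` fixes each leg of `Δ(x)` separately, by one coideal condition
for each leg, hence `Δ(x) = (p ⊗ p)Δ(x)`. -/
theorem isSubcoalgebra_of_coideals [FiniteDimensional k C] {D : Submodule k C}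
    (hr : IsRightCoideal D) (hl : IsLeftCoideal D) : IsSubcoalgebra k D := by
  intro x hx
  obtain ⟨p, hp⟩ := exists_leftInverse_subtype D
  refine ⟨TensorProduct.map p p (Coalgebra.comul x), ?_⟩
  conv_rhs => rw [← hr.rTensor_comul hp hx, ← hl.lTensor_comul hp hx]
  rw [TensorProduct.mapIncl, ← LinearMap.comp_apply, ← TensorProduct.map_comp,
    ← LinearMap.comp_apply (LinearMap.rTensor _ _), LinearMap.rTensor_comp_lTensor]

theorem isSubcoalgebra_sSup [FiniteDimensional k C] {s : Set (Submodule k C)}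
    (hs : ∀ D ∈ s, IsSubcoalgebra k D) : IsSubcoalgebra k (sSup s) := by
  refine isSubcoalgebra_of_coideals (fun φ ↦ ?_) (fun φ ↦ ?_)
  · refine (sSup_le fun D hD x hx ↦ ?_ : sSup s ≤ (sSup s).comap (rTrans φ))
    exact le_sSup hD (isRightCoideal_of_isSubcoalgebra (hs D hD) φ x hx)
  · refine (sSup_le fun D hD x hx ↦ ?_ : sSup s ≤ (sSup s).comap (lTrans φ))
    exact le_sSup hD (isLeftCoideal_of_isSubcoalgebra (hs D hD) φ x hx)

theorem exists_isSimpleSubcoalgebra_le [FiniteDimensional k C] {D : Submodule k C}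
    (hD : IsSubcoalgebra k D) (h0 : D ≠ ⊥) : ∃ E ≤ D, IsSimpleSubcoalgebra k E := by
  obtain ⟨E, ⟨hE, hE0, hED⟩, hmin⟩ := WellFounded.has_min
    (wellFounded_lt (α := Submodule k C)) {E | IsSubcoalgebra k E ∧ E ≠ ⊥ ∧ E ≤ D}
    ⟨D, hD, h0, le_rfl⟩
  refine ⟨E, hED, hE, hE0, fun F hF hFE ↦ ?_⟩
  by_contra! hc
  exact hmin F ⟨hF, hc.1, hFE.trans hED⟩ (lt_of_le_of_ne hFE hc.2)

/-- A coseparability form: a bilinear form `B` with `x₁ B(x₂, y) = B(x, y₁) y₂` and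
`B(x₁, x₂) = ε(x)`. -/
structure IsCoseparabilityForm (B : C →ₗ[k] C →ₗ[k] k) : Prop where
  trans_eq : ∀ x y, rTrans (B.flip y) x = lTrans (B x) y
  lift_comul : ∀ x, TensorProduct.lift B (Coalgebra.comul x) = Coalgebra.counit (R := k) x

namespace IsCoseparabilityForm

variable {B : C →ₗ[k] C →ₗ[k] k}

theorem exists_lTrans_map (hB : IsCoseparabilityForm B) : ∃ E : C ⊗[k] C →ₗ[k] C,
    (∀ x y, E (x ⊗ₜ y) = lTrans (B x) y) ∧ ∀ x, E (Coalgebra.comul x) = x := by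
  let E : C ⊗[k] C →ₗ[k] C := (TensorProduct.lid k C).toLinearMap ∘ₗ
    (TensorProduct.lift B).rTensor C ∘ₗ (TensorProduct.assoc k C C C).symm.toLinearMap ∘ₗ
      Coalgebra.comul.lTensor C
  refine ⟨E, fun x y ↦ ?_, fun x ↦ ?_⟩
  · have : ∀ Y : C ⊗[k] C, TensorProduct.lid k C ((TensorProduct.lift B).rTensor C
        ((TensorProduct.assoc k C C C).symm (x ⊗ₜ Y))) =
        TensorProduct.lid k C ((B x).rTensor C Y) := by
      intro Y
      induction Y with
      | zero => simp
      | add x y hx hy => simp only [map_add, TensorProduct.tmul_add, hx, hy]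
      | tmul b c => simp
    simpa only [E, LinearMap.comp_apply, LinearEquiv.coe_coe, LinearMap.lTensor_tmul,
      lTrans_apply] using this (Coalgebra.comul y)
  · have h1 : TensorProduct.lift B ∘ₗ Coalgebra.comul = Coalgebra.counit (R := k) :=
      LinearMap.ext hB.lift_comul
    simp only [E, LinearMap.comp_apply, LinearEquiv.coe_coe]
    rw [Coalgebra.coassoc_symm_apply, ← LinearMap.comp_apply, ← LinearMap.rTensor_comp, h1,
      Coalgebra.rTensor_counit_comul]
    simp

/-- Maschke averaging: the form turns a linear projection onto `K` into one that commutes with right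
translations, and its kernel is the complement. -/
theorem exists_isCompl_rightCoideal [FiniteDimensional k C] (hB : IsCoseparabilityForm B) {K : Submodule k C}
    (hK : IsRightCoideal K) : ∃ W : Submodule k C, IsRightCoideal W ∧ IsCompl K W := by
  obtain ⟨E, hE, hE'⟩ := hB.exists_lTrans_map
  obtain ⟨p, hp⟩ := exists_leftInverse_subtype K
  let P : C →ₗ[k] C := K.subtype ∘ₗ p
  have hPm : ∀ x, P x ∈ K := fun x ↦ (p x).2
  -- `f(x) = B(P x₁, x₂) x₃`. It lands in `K` because `trans_eq` rewrites it as a sum of right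
  -- translates of elements of `K`.
  let f : C →ₗ[k] C := E ∘ₗ P.rTensor C ∘ₗ Coalgebra.comul
  have hf : ∀ x, f x ∈ K := by
    intro x
    have : ∀ X : C ⊗[k] C, E (P.rTensor C X) ∈ K := by
      intro X
      induction X with
      | zero => simp
      | add x y hx hy => simp only [map_add]; exact K.add_mem hx hy
      | tmul a b =>
        rw [LinearMap.rTensor_tmul, hE, ← hB.trans_eq]
        exact hK _ _ (hPm a)
    exact this (Coalgebra.comul x)
  have hfK : ∀ x ∈ K, f x = x := by
    intro x hx
    simp only [f, LinearMap.comp_apply]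
    rw [hK.rTensor_comul hp hx, hE']
  have hcomm : ∀ (χ : C →ₗ[k] k) (x : C), f (rTrans χ x) = rTrans χ (f x) := by
    intro χ x
    have : ∀ X : C ⊗[k] C, E (P.rTensor C ((rTrans χ).lTensor C X)) =
        rTrans χ (E (P.rTensor C X)) := by
      intro X
      induction X with
      | zero => simp
      | add x y hx hy => simp only [map_add, hx, hy]
      | tmul a b => simp only [LinearMap.rTensor_tmul, LinearMap.lTensor_tmul, hE, rTrans_lTrans]
    simp only [f, LinearMap.comp_apply]
    rw [comul_rTrans, this]
  refine ⟨LinearMap.ker f, fun χ x hx ↦ ?_, ?_⟩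
  · rw [LinearMap.mem_ker] at hx ⊢
    rw [hcomm, hx, map_zero]
  · have h1 := LinearMap.isCompl_of_proj (f := f.codRestrict K hf)
      (fun x ↦ Subtype.ext (hfK x x.2))
    rwa [LinearMap.ker_codRestrict] at h1

/-- The annihilator `I` of `D` is a two-sided ideal of the dual algebra, and the complement is `I ·
C`. Conversely, `D` is the set of elements killed by `I`. -/
theorem exists_isCompl_subcoalgebra [FiniteDimensional k C] (hB : IsCoseparabilityForm B)
    {D : Submodule k C} (hD : IsSubcoalgebra k D) :
    ∃ D' : Submodule k C, IsSubcoalgebra k D' ∧ IsCompl D D' := by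
  have hDr := isRightCoideal_of_isSubcoalgebra hD
  let D' : Submodule k C :=
    ⨆ φ : {φ : C →ₗ[k] k // ∀ x ∈ D, φ x = 0}, LinearMap.range (rTrans φ.1)
  have hmem : ∀ φ : C →ₗ[k] k, (∀ x ∈ D, φ x = 0) → ∀ h, rTrans φ h ∈ D' := fun φ hφ h ↦
    Submodule.mem_iSup_of_mem (p := fun φ : {φ : C →ₗ[k] k // ∀ x ∈ D, φ x = 0} ↦
      LinearMap.range (rTrans φ.1)) ⟨φ, hφ⟩ ⟨h, rfl⟩
  have hle : ∀ U : Submodule k C,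
      (∀ φ : C →ₗ[k] k, (∀ x ∈ D, φ x = 0) → ∀ h, rTrans φ h ∈ U) → D' ≤ U := by
    intro U hU
    refine iSup_le fun φ ↦ ?_
    rintro _ ⟨h, rfl⟩
    exact hU φ.1 φ.2 h
  have hmemD : ∀ h, (∀ φ : C →ₗ[k] k, (∀ x ∈ D, φ x = 0) → rTrans φ h = 0) → h ∈ D := by
    intro h hh
    by_contra hc
    obtain ⟨φ, hφ, hφD⟩ := Submodule.exists_le_ker_of_notMem hc
    apply hφ
    rw [← counit_rTrans, hh φ fun x hx ↦ hφD hx, map_zero]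
  have hr : IsRightCoideal D' := by
    intro χ
    refine (hle (D'.comap (rTrans χ)) fun φ hφ h ↦ ?_ : D' ≤ D'.comap (rTrans χ))
    rw [Submodule.mem_comap, rTrans_rTrans]
    refine hmem _ (fun x hx ↦ ?_) h
    rw [← counit_rTrans, ← rTrans_rTrans, rTrans_eq_zero hD hφ hx, map_zero, map_zero]
  have hl : IsLeftCoideal D' := by
    intro χ
    refine (hle (D'.comap (lTrans χ)) fun φ hφ h ↦ ?_ : D' ≤ D'.comap (lTrans χ))
    rw [Submodule.mem_comap, ← rTrans_lTrans]
    exact hmem φ hφ _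
  refine ⟨D', isSubcoalgebra_of_coideals hr hl, ?_, ?_⟩
  -- Since `I` kills `D ⊓ D'`, all of `I · C` already comes from the complement `U`; so `D' ≤ U`,
  -- and `D ⊓ D'` meets its own complement in itself.
  · obtain ⟨U, hU, hc⟩ := hB.exists_isCompl_rightCoideal (K := D ⊓ D')
      fun φ x hx ↦ ⟨hDr φ x hx.1, hr φ x hx.2⟩
    have hDU : D' ≤ U := by
      refine hle U fun φ hφ h ↦ ?_
      obtain ⟨a, ha, b, hb, rfl⟩ := Submodule.mem_sup.1
        (hc.sup_eq_top.ge (Submodule.mem_top (x := h)))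
      rw [map_add, rTrans_eq_zero hD hφ ha.1, zero_add]
      exact hU φ b hb
    rw [disjoint_iff]
    exact disjoint_self.1 (hc.disjoint.mono_right (inf_le_right.trans hDU))
  -- `I · W` lies in both `W` and `D'`, hence is zero, so `W ≤ D`.
  · obtain ⟨W, hW, hc⟩ := hB.exists_isCompl_rightCoideal hr
    rw [codisjoint_iff, eq_top_iff, ← hc.sup_eq_top]
    refine sup_le le_sup_right (le_sup_of_le_left fun w hw ↦ hmemD w fun φ hφ ↦ ?_)
    exact (Submodule.mem_bot k).1 (hc.inf_eq_bot.le ⟨hmem φ hφ w, hW φ w hw⟩)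

theorem isCosemisimple [FiniteDimensional k C] (hB : IsCoseparabilityForm B) :
    IsCosemisimple k C := by
  obtain ⟨D, hD, hc⟩ := hB.exists_isCompl_subcoalgebra
    (isSubcoalgebra_sSup (s := {D : Submodule k C | IsSimpleSubcoalgebra k D}) fun D hD ↦ hD.1)
  by_contra hne
  have hD0 : D ≠ ⊥ := fun h ↦ hne (by rw [IsCosemisimple, ← hc.sup_eq_top, h, sup_bot_eq])
  obtain ⟨E, hED, hE⟩ := exists_isSimpleSubcoalgebra_le hD hD0
  exact hE.2.1 (le_bot_iff.1 (hc.inf_eq_bot ▸ le_inf (le_sSup hE) hED))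

end IsCoseparabilityForm

end Subcoalgebras

/-! ### Integrals on a Hopf algebra -/

section Integrals

variable {k H : Type*} [Field k] [Ring H] [HopfAlgebra k H]

-- The elements `Δ(x)(1 ⊗ y)` span `H ⊗ H`, because `x ⊗ y = x₁ ⊗ x₂S(x₃)y`.
open HopfTwist in
theorem eq_of_comul_mul_one_tmul {M : Type*} [AddCommGroup M] [Module k M]
    {E₁ E₂ : H ⊗[k] H →ₗ[k] M} (h : ∀ x y, E₁ (Coalgebra.comul x * ((1 : H) ⊗ₜ y)) =
      E₂ (Coalgebra.comul x * ((1 : H) ⊗ₜ y))) : E₁ = E₂ := by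
  have h1 : ∀ (y : H) (X : H ⊗[k] H), E₁ ((G 1).lTensor H (f1 X) * (1 ⊗ₜ y)) =
      E₂ ((G 1).lTensor H (f1 X) * (1 ⊗ₜ y)) := by
    intro y X
    induction X with
    | zero => simp
    | add u v hu hv => simp only [map_add, add_mul, hu, hv]
    | tmul a b =>
      have h2 : ∀ Y : H ⊗[k] H, (G 1).lTensor H
          (Algebra.TensorProduct.assoc k k k H H H (Y ⊗ₜ b)) = Y * (1 ⊗ₜ HopfAlgebra.antipode k b) := by
        intro Y
        induction Y with
        | zero => simp
        | add u v hu hv => simp only [map_add, TensorProduct.add_tmul, add_mul, hu, hv]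
        | tmul u v => simp [G_tmul]
      have h3 : (G 1).lTensor H (f1 (a ⊗ₜ b)) =
          Coalgebra.comul (R := k) a * (1 ⊗ₜ HopfAlgebra.antipode k b) := by
        rw [← h2]
        rfl
      rw [h3, mul_assoc, Algebra.TensorProduct.tmul_mul_tmul, one_mul, h]
  have h4 : ∀ X : H ⊗[k] H, (G 1).lTensor H (f2 X) = eR X ⊗ₜ 1 := by
    intro X
    induction X with
    | zero => simp
    | add u v hu hv => simp only [map_add, TensorProduct.add_tmul, hu, hv]
    | tmul a b =>
      simp [f2, G_one_comul, eR_tmul, Algebra.algebraMap_eq_smul_one, TensorProduct.smul_tmul']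
  ext x y
  have h5 := h1 y (Coalgebra.comul x)
  rw [f1_comul, h4, eR_comul, Algebra.TensorProduct.tmul_mul_tmul, one_mul, mul_one] at h5
  exact h5

-- The form is `B(x, y) = l(S(x)y)`. For `trans_eq`, both sides are tested on `Δ(x)(1 ⊗ y)`, where
-- the antipode cancels and each gives `l(y)x`; only the second computation needs the invariance of
-- `l`.
open HopfTwist in
theorem isCoseparabilityForm_of_integral {l : H →ₗ[k] k} (h1 : l 1 = 1)
    (hl : ∀ h, lTrans l h = l h • (1 : H)) :
    IsCoseparabilityForm ((LinearMap.mul k H).compr₂ l ∘ₗ HopfAlgebra.antipode k) := by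
  have hmul : ∀ Z : H ⊗[k] H, l (F 1 Z) = TensorProduct.lift
      ((LinearMap.mul k H).compr₂ l ∘ₗ HopfAlgebra.antipode k) Z := by
    intro Z
    induction Z with
    | zero => simp
    | add x y hx hy => simp only [map_add, hx, hy]
    | tmul a b => simp [F_tmul]
  constructor
  · let E₁ : H ⊗[k] H →ₗ[k] H :=
      (TensorProduct.rid k H).toLinearMap ∘ₗ (l ∘ₗ F 1).lTensor H ∘ₗ f1.toLinearMap
    let E₂ : H ⊗[k] H →ₗ[k] H := (TensorProduct.lid k H).toLinearMap ∘ₗ (l ∘ₗ F 1).rTensor H ∘ₗ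
      (TensorProduct.assoc k H H H).symm.toLinearMap ∘ₗ f2.toLinearMap
    have hE₁ : ∀ x y, E₁ (x ⊗ₜ y) = rTrans
        (((LinearMap.mul k H).compr₂ l ∘ₗ HopfAlgebra.antipode k).flip y) x := by
      intro x y
      have : ∀ X : H ⊗[k] H, TensorProduct.rid k H ((l ∘ₗ F 1).lTensor H
          (Algebra.TensorProduct.assoc k k k H H H (X ⊗ₜ y))) = TensorProduct.rid k H
          ((((LinearMap.mul k H).compr₂ l ∘ₗ HopfAlgebra.antipode k).flip y).lTensor H X) := by
        intro X
        induction X with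
        | zero => simp
        | add x y hx hy => simp only [map_add, TensorProduct.add_tmul, hx, hy]
        | tmul a b => simp [F_tmul]
      rw [rTrans_apply, ← this]
      rfl
    have hE₂ : ∀ x y, E₂ (x ⊗ₜ y) = lTrans
        (((LinearMap.mul k H).compr₂ l ∘ₗ HopfAlgebra.antipode k) x) y := by
      intro x y
      have : ∀ X : H ⊗[k] H, TensorProduct.lid k H ((l ∘ₗ F 1).rTensor H
          ((TensorProduct.assoc k H H H).symm (x ⊗ₜ X))) = TensorProduct.lid k H
          ((((LinearMap.mul k H).compr₂ l ∘ₗ HopfAlgebra.antipode k) x).rTensor H X) := by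
        intro X
        induction X with
        | zero => simp
        | add x y hx hy => simp only [map_add, TensorProduct.tmul_add, hx, hy]
        | tmul a b => simp [F_tmul]
      rw [lTrans_apply, ← this]
      simp [E₂, f2]
    have hβ₁ : ∀ x y, E₁ (Coalgebra.comul x * (1 ⊗ₜ y)) = l y • x := by
      intro x y
      have : ∀ X : H ⊗[k] H, TensorProduct.rid k H ((l ∘ₗ F 1).lTensor H
          (f2 X * f1 (1 ⊗ₜ y))) = l y • eR X := by
        intro X
        induction X with
        | zero => simp
        | add x y hx hy => simp only [map_add, add_mul, smul_add, hx, hy]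
        | tmul a b =>
          have : f1 ((1 : H) ⊗ₜ[k] y) = (1 : H) ⊗ₜ[k] ((1 : H) ⊗ₜ[k] y) := by
            simp [f1, Algebra.TensorProduct.one_def]
          simp [this, f2, F_mul, F_one_comul, F_tmul, eR_tmul, smul_smul,
            Algebra.algebraMap_eq_smul_one, mul_comm]
      have h2 := this (Coalgebra.comul x)
      rw [eR_comul, ← f1_comul, ← map_mul] at h2
      exact h2
    have hβ₂ : ∀ x y, E₂ (Coalgebra.comul x * (1 ⊗ₜ y)) = l y • x := by
      intro x y
      have : ∀ X : H ⊗[k] H, TensorProduct.lid k H ((l ∘ₗ F 1).rTensor H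
          ((TensorProduct.assoc k H H H).symm (f1 X * f2 (1 ⊗ₜ y)))) = l y • eL X := by
        intro X
        induction X with
        | zero => simp
        | add x y hx hy => simp only [map_add, add_mul, smul_add, hx, hy]
        | tmul a b =>
          have h3 : ∀ X Y : H ⊗[k] H, TensorProduct.lid k H ((l ∘ₗ F 1).rTensor H
              ((TensorProduct.assoc k H H H).symm
                (Algebra.TensorProduct.assoc k k k H H H (X ⊗ₜ b) * ((1 : H) ⊗ₜ Y)))) =
              b * TensorProduct.lid k H ((l ∘ₗ LinearMap.mulLeft k (F 1 X)).rTensor H Y) := by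
            intro X Y
            induction Y with
            | zero => simp
            | add x y hx hy => simp only [map_add, TensorProduct.tmul_add, mul_add, hx, hy]
            | tmul c d =>
              induction X with
              | zero => simp
              | add x y hx hy =>
                simp only [map_add, TensorProduct.add_tmul, mul_add, add_mul, hx, hy,
                  LinearMap.rTensor_tmul, LinearMap.comp_apply, LinearMap.mulLeft_apply,
                  TensorProduct.lid_tmul]
              | tmul u v => simp [F_tmul]
          have h4 : l ∘ₗ LinearMap.mulLeft k (F 1 (Coalgebra.comul (R := k) a)) =
              Coalgebra.counit (R := k) a • l := by
            ext z
            simp [F_one_comul, Algebra.algebraMap_eq_smul_one]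
          have h5 := h3 (Coalgebra.comul a) (Coalgebra.comul y)
          have h6 := hl y
          rw [lTrans_apply] at h6
          rw [h4, LinearMap.rTensor_smul, LinearMap.smul_apply, map_smul, h6] at h5
          simp only [f1, f2, eL_tmul]
          refine (Eq.trans ?_ h5).trans ?_
          · simp
          · simp [smul_smul, mul_comm]
      have h2 := this (Coalgebra.comul x)
      rw [eL_comul, f1_comul, ← map_mul] at h2
      exact h2
    have hE : E₁ = E₂ := eq_of_comul_mul_one_tmul fun x y ↦ (hβ₁ x y).trans (hβ₂ x y).symm
    intro x y
    rw [← hE₁, ← hE₂, hE]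
  · intro x
    rw [← hmul, F_one_comul, Algebra.algebraMap_eq_smul_one, map_smul, h1]
    simp

/-- A convolution product of functionals, one killing each `D`: a factor vanishing on a subcoalgebra
makes the product vanish there, and values at the grouplike 1 multiply. -/
theorem exists_functional_of_notMem_one {s : Finset (Submodule k H)}
    (hs : ∀ D ∈ s, IsSubcoalgebra k D) (h1 : ∀ D ∈ s, (1 : H) ∉ D) :
    ∃ φ : H →ₗ[k] k, φ 1 = 1 ∧ ∀ D ∈ s, ∀ x ∈ D, φ x = 0 := by
  classical
  induction s using Finset.induction_on with
  | empty =>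
    exact ⟨Coalgebra.counit, by simp, by simp⟩
  | insert D s _ ih =>
    obtain ⟨φ, hφ, hφs⟩ := ih (fun D hD ↦ hs D (Finset.mem_insert_of_mem hD))
      (fun D hD ↦ h1 D (Finset.mem_insert_of_mem hD))
    obtain ⟨ψ, hψ, hψD⟩ := Submodule.exists_le_ker_of_notMem (h1 D (Finset.mem_insert_self D s))
    refine ⟨conv ((ψ 1)⁻¹ • ψ) φ, ?_, fun E hE x hx ↦ conv_eq_zero (hs E hE) ?_ hx⟩
    · simp [conv, Algebra.TensorProduct.one_def, hφ, hψ]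
    · rcases Finset.mem_insert.1 hE with rfl | hE
      · exact Or.inl fun x hx ↦ by simp [LinearMap.mem_ker.1 (hψD hx)]
      · exact Or.inr (hφs E hE)

theorem isSubcoalgebra_span_one : IsSubcoalgebra k (Submodule.span k {(1 : H)}) := by
  intro x hx
  obtain ⟨c, rfl⟩ := Submodule.mem_span_singleton.1 hx
  have h1 : (1 : H) ∈ Submodule.span k {(1 : H)} := Submodule.mem_span_singleton_self 1
  exact ⟨c • (⟨1, h1⟩ ⊗ₜ ⟨1, h1⟩),
    by simp [TensorProduct.mapIncl, Algebra.TensorProduct.one_def]⟩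

/-- A finite-dimensional cosemisimple Hopf algebra has a normalized two-sided integral on it. -/
theorem exists_integral_of_isCosemisimple [FiniteDimensional k H] (h : IsCosemisimple k H) :
    ∃ l : H →ₗ[k] k, l 1 = 1 ∧ (∀ x, lTrans l x = l x • (1 : H)) ∧
      ∀ x, rTrans l x = l x • (1 : H) := by
  -- Finitely many simple subcoalgebras avoiding 1 have the same sum as all of them, so one
  -- functional kills them all. The remaining simple subcoalgebra is `k1`, and invariance can be
  -- checked piece by piece.
  obtain ⟨s, hs, hsup⟩ := (CompleteLattice.WellFoundedGT.isSupFiniteCompact (Submodule k H))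
    {D | IsSimpleSubcoalgebra k D ∧ (1 : H) ∉ D}
  have hs' : ∀ D ∈ s, IsSimpleSubcoalgebra k D ∧ (1 : H) ∉ D := fun D hD ↦ hs hD
  obtain ⟨l, hl, hls⟩ := exists_functional_of_notMem_one (fun D hD ↦ (hs' D hD).1.1)
    (fun D hD ↦ (hs' D hD).2)
  have hzero : ∀ D : Submodule k H, IsSimpleSubcoalgebra k D → (1 : H) ∉ D →
      ∀ x ∈ D, l x = 0 := by
    intro D hD h1 x hx
    have h2 : s.sup id ≤ LinearMap.ker l := Finset.sup_le fun E hE y hy ↦ hls E hE y hy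
    have h3 : D ≤ s.sup id := hsup ▸ le_sSup ⟨hD, h1⟩
    exact h2 (h3 hx)
  have hext : ∀ f g : H →ₗ[k] H, f 1 = g 1 → (∀ D : Submodule k H, IsSubcoalgebra k D →
      (∀ x ∈ D, l x = 0) → ∀ x ∈ D, f x = g x) → ∀ x, f x = g x := by
    intro f g h1 h2 x
    have h3 : (⊤ : Submodule k H) ≤ LinearMap.eqLocus f g := by
      rw [← h]
      refine sSup_le fun D hD ↦ ?_
      by_cases hD1 : (1 : H) ∈ D
      · have h4 : Submodule.span k {(1 : H)} ≤ D := by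
          rwa [Submodule.span_singleton_le_iff_mem]
        rcases hD.2.2 _ isSubcoalgebra_span_one h4 with h5 | h5
        · have : (1 : H) = 0 := Submodule.span_singleton_eq_bot.1 h5
          rw [this, map_zero] at hl
          exact absurd hl zero_ne_one
        · rw [← h5, Submodule.span_singleton_le_iff_mem]
          exact h1
      · exact fun x hx ↦ h2 D hD.1 (hzero D hD hD1) x hx
    exact h3 Submodule.mem_top
  refine ⟨l, hl, hext (lTrans l) (l.smulRight 1) ?_ ?_, hext (rTrans l) (l.smulRight 1) ?_ ?_⟩
  · simp [lTrans_apply, Algebra.TensorProduct.one_def]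
  · intro D hD h0 x hx
    simp [lTrans_eq_zero hD h0 hx, h0 x hx]
  · simp [rTrans_apply, Algebra.TensorProduct.one_def]
  · intro D hD h0 x hx
    simp [rTrans_eq_zero hD h0 hx, h0 x hx]

end Integrals

section Translations

variable {k C : Type*} [Field k] [AddCommGroup C] [Module k C] [Coalgebra k C]

theorem counit_lTrans (φ : C →ₗ[k] k) (h : C) :
    Coalgebra.counit (R := k) (lTrans φ h) = φ h := by
  have : ∀ X : C ⊗[k] C, Coalgebra.counit (R := k) (TensorProduct.lid k C (φ.rTensor C X)) =
      φ (TensorProduct.rid k C (Coalgebra.counit.lTensor C X)) := by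
    intro X
    induction X with
    | zero => simp
    | add x y hx hy => simp only [map_add, hx, hy]
    | tmul a b => simp [mul_comm]
  rw [lTrans_apply, this, Coalgebra.lTensor_counit_comul]
  simp

theorem apply_rTrans (φ ψ : C →ₗ[k] k) (h : C) : φ (rTrans ψ h) = ψ (lTrans φ h) := by
  rw [← counit_lTrans φ, ← rTrans_lTrans, counit_rTrans]

theorem lTrans_counit (h : C) : lTrans (Coalgebra.counit (R := k)) h = h := by
  rw [lTrans_apply, Coalgebra.rTensor_counit_comul]
  simp

theorem lTrans_add (φ ψ : C →ₗ[k] k) (h : C) :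
    lTrans (φ + ψ) h = lTrans φ h + lTrans ψ h := by
  simp [lTrans_apply, LinearMap.rTensor_add]

theorem lTrans_smul (c : k) (φ : C →ₗ[k] k) (h : C) :
    lTrans (c • φ) h = c • lTrans φ h := by
  simp [lTrans_apply, LinearMap.rTensor_smul]

theorem lTrans_zero (h : C) : lTrans (0 : C →ₗ[k] k) h = 0 := by
  simp [lTrans_apply]

end Translations

/-! ### Nondegeneracy and the Nakayama automorphism of an integral -/

section Nakayama

variable {k H : Type*} [Field k] [Ring H] [HopfAlgebra k H]

-- The identity map has convolution inverse `S`, so it can be cancelled on the right.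
open WithConv in
theorem eq_of_mul_comul {f g : H →ₗ[k] H}
    (h : ∀ x, LinearMap.mul' k H (f.rTensor H (Coalgebra.comul x)) =
      LinearMap.mul' k H (g.rTensor H (Coalgebra.comul x))) : f = g := by
  have h1 : toConv f * toConv LinearMap.id = toConv g * toConv LinearMap.id := by
    ext x
    exact h x
  have h2 : toConv (LinearMap.id : H →ₗ[k] H) * toConv (HopfAlgebra.antipode k) = 1 := by
    ext x
    exact HopfAlgebra.mul_antipode_lTensor_comul_apply x
  have h3 := congrArg (· * toConv (HopfAlgebra.antipode k)) h1
  simp only [mul_assoc, h2, mul_one] at h3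
  exact toConv_injective h3

open HopfTwist in
/-- `l(x₁ y) x₂ = l(x y₁) S(y₂)` for an integral `l`. -/
theorem lTrans_mulRight {l : H →ₗ[k] k} (hl : ∀ h, lTrans l h = l h • (1 : H)) (x y : H) :
    lTrans (l ∘ₗ LinearMap.mulRight k y) x =
      HopfAlgebra.antipode k (lTrans (l ∘ₗ LinearMap.mulLeft k x) y) := by
  let A : H →ₗ[k] H :=
    { toFun := fun y ↦ lTrans (l ∘ₗ LinearMap.mulRight k y) x
      map_add' := fun y z ↦ by
        rw [← lTrans_add]
        congr 2
        ext
        simp [mul_add]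
      map_smul' := fun c y ↦ by
        rw [RingHom.id_apply, ← lTrans_smul]
        congr 2
        ext
        simp }
  suffices h : A = HopfAlgebra.antipode k ∘ₗ lTrans (l ∘ₗ LinearMap.mulLeft k x) from
    LinearMap.congr_fun h y
  -- Convolved with the identity, both sides send `y` to `l(xy)1`.
  refine eq_of_mul_comul fun y ↦ ?_
  have h1 : ∀ Y : H ⊗[k] H, LinearMap.mul' k H (A.rTensor H Y) =
      TensorProduct.lid k H (l.rTensor H (Coalgebra.comul x * Y)) := by
    intro Y
    induction Y with
    | zero => simp
    | add u v hu hv => simp only [map_add, mul_add, hu, hv]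
    | tmul a b =>
      simp only [A, LinearMap.rTensor_tmul, LinearMap.coe_mk, AddHom.coe_mk, LinearMap.mul'_apply,
        lTrans_apply]
      generalize Coalgebra.comul (R := k) x = X
      induction X with
      | zero => simp
      | add u v hu hv => simp only [map_add, add_mul, hu, hv]
      | tmul c d => simp
  rw [h1, ← Bialgebra.comul_mul, ← lTrans_apply, hl, LinearMap.rTensor_comp, LinearMap.comp_apply,
    ← comul_lTrans, HopfAlgebra.mul_antipode_rTensor_comul_apply, counit_lTrans,
    Algebra.algebraMap_eq_smul_one]
  simp

-- The radical of the form `l(ab)` is stable under right translations by `lTrans_mulRight`, and `ε`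
-- vanishes on it since `ε(a) = l(a₁S(a₂))`. A right translation turns `ε` into any functional, so
-- the radical is zero.
open HopfTwist in
theorem eq_zero_of_integral_mul_eq_zero [FiniteDimensional k H] {l : H →ₗ[k] k} (h1 : l 1 = 1)
    (hl : ∀ h, lTrans l h = l h • (1 : H)) {a : H} (ha : ∀ b, l (a * b) = 0) : a = 0 := by
  have hr : ∀ ψ : H →ₗ[k] k, ∀ a : H, (∀ b, l (a * b) = 0) → ∀ b, l (rTrans ψ a * b) = 0 := by
    intro ψ a ha b
    have h2 : l ∘ₗ LinearMap.mulLeft k a = 0 := LinearMap.ext ha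
    have h3 := apply_rTrans (l ∘ₗ LinearMap.mulRight k b) ψ a
    rw [lTrans_mulRight hl, h2, lTrans_zero, map_zero, map_zero] at h3
    simpa using h3
  have he : ∀ a : H, (∀ b, l (a * b) = 0) → Coalgebra.counit (R := k) a = 0 := by
    intro a ha
    let b := Module.finBasis k H
    have h2 := congrArg l (G_one_comul (k := k) a)
    rw [Algebra.algebraMap_eq_smul_one, map_smul, h1, smul_eq_mul, mul_one,
      ← sum_rid_lTensor_tmul b (Coalgebra.comul a), map_sum, map_sum] at h2
    rw [← h2]
    refine Finset.sum_eq_zero fun i _ ↦ ?_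
    rw [G_tmul, mul_one, ← rTrans_apply, hr _ a ha]
  rw [← Module.forall_dual_apply_eq_zero_iff k]
  intro ψ
  rw [← counit_rTrans]
  exact he _ (hr ψ a ha)

open HopfTwist in
/-- `S(a) t₁ ⊗ t₂ = t₁ ⊗ a t₂` for a left integral `t`. -/
theorem antipode_tmul_one_mul_comul {t : H} (ht : t ∈ leftIntegrals k H) (a : H) :
    (HopfAlgebra.antipode k a ⊗ₜ[k] (1 : H)) * Coalgebra.comul t =
      ((1 : H) ⊗ₜ[k] a) * Coalgebra.comul t := by
  -- `T` is `x ⊗ y ⊗ z ↦ S(x)y ⊗ z`. The element `S(a₁)a₂t₁ ⊗ a₃t₂` is computed in two ways,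
  -- cancelling `S(a₁)a₂` or absorbing `a₂t` into `t`.
  let T : H ⊗[k] (H ⊗[k] H) →ₗ[k] H ⊗[k] H := (F 1).rTensor H ∘ₗ
    (TensorProduct.assoc k H H H).symm.toLinearMap
  have h1 : ∀ X : H ⊗[k] H, T (f1 X) = (1 : H) ⊗ₜ (TensorProduct.lid k H
      (Coalgebra.counit.rTensor H X)) := by
    intro X
    induction X with
    | zero => simp
    | add u v hu hv => simp only [map_add, TensorProduct.tmul_add, hu, hv]
    | tmul a b =>
      have h2 : T (f1 (a ⊗ₜ b)) = F 1 (Coalgebra.comul (R := k) a) ⊗ₜ[k] b := by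
        simp only [T, f1, LinearMap.comp_apply, LinearEquiv.coe_coe]
        change (F 1).rTensor H ((TensorProduct.assoc k H H H).symm
          (TensorProduct.assoc k H H H (Coalgebra.comul a ⊗ₜ b))) = _
        simp
      rw [h2, F_one_comul]
      simp [Algebra.algebraMap_eq_smul_one, TensorProduct.smul_tmul]
  have h3 : ∀ X : H ⊗[k] H, T (f2 X) * Coalgebra.comul t = (HopfAlgebra.antipode k
      (TensorProduct.rid k H (Coalgebra.counit.lTensor H X)) ⊗ₜ (1 : H)) * Coalgebra.comul t := by
    intro X
    induction X with
    | zero => simp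
    | add u v hu hv => simp only [map_add, add_mul, TensorProduct.add_tmul, hu, hv]
    | tmul a b =>
      have h4 : ∀ Y : H ⊗[k] H, T (a ⊗ₜ Y) = (HopfAlgebra.antipode k a ⊗ₜ (1 : H)) * Y := by
        intro Y
        induction Y with
        | zero => simp
        | add u v hu hv => simp only [map_add, mul_add, TensorProduct.tmul_add, hu, hv]
        | tmul c d => simp [T, F_tmul]
      have h5 : f2 (a ⊗ₜ[k] b) = a ⊗ₜ Coalgebra.comul (R := k) b := by simp [f2]
      rw [h5, h4, mul_assoc, ← Bialgebra.comul_mul, ht b]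
      simp [← TensorProduct.smul_tmul']
  have h6 := h3 (Coalgebra.comul a)
  rw [← f1_comul, h1, Coalgebra.rTensor_counit_comul, Coalgebra.lTensor_counit_comul] at h6
  simpa using h6.symm

/-- In a unimodular Hopf algebra, the Nakayama automorphism of a normalized integral is `S²`. -/
theorem integral_mul_comm [FiniteDimensional k H] (hu : IsUnimodular k H) {l : H →ₗ[k] k}
    (h1 : l 1 = 1) (hl : ∀ h, lTrans l h = l h • (1 : H)) (a x : H) :
    l (x * a) = l (HopfAlgebra.antipode k (HopfAlgebra.antipode k a) * x) := by
  let Φ : H →ₗ[k] Module.Dual k H := (LinearMap.mul k H).compr₂ l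
  have hΦ : Function.Injective Φ := by
    rw [injective_iff_map_eq_zero]
    exact fun a ha ↦ eq_zero_of_integral_mul_eq_zero h1 hl fun b ↦ LinearMap.congr_fun ha b
  have hdim : Module.finrank k H = Module.finrank k (Module.Dual k H) :=
    Subspace.dual_finrank_eq.symm
  -- Nondegeneracy represents `ε` as `l(t ·)`, which forces `t` to be a right integral;
  -- unimodularity then makes it a left one.
  obtain ⟨t, ht⟩ := (LinearMap.injective_iff_surjective_of_finrank_eq_finrank hdim).1 hΦ
    Coalgebra.counit
  have ht' : ∀ b, l (t * b) = Coalgebra.counit (R := k) b := fun b ↦ LinearMap.congr_fun ht b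
  have htr : t ∈ rightIntegrals k H := by
    intro h
    apply hΦ
    ext b
    simp [Φ, mul_assoc, ht']
  have htl : t ∈ leftIntegrals k H := hu ▸ htr
  have hright : ∀ y, lTrans (l ∘ₗ LinearMap.mulRight k y) t = HopfAlgebra.antipode k y := by
    intro y
    have h2 : l ∘ₗ LinearMap.mulLeft k t = Coalgebra.counit := LinearMap.ext ht'
    rw [lTrans_mulRight hl, h2, lTrans_counit]
  have hleft : ∀ y, lTrans (l ∘ₗ LinearMap.mulLeft k (HopfAlgebra.antipode k y)) t = y := by
    intro y
    have h2 : ∀ X : H ⊗[k] H, TensorProduct.lid k H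
        ((l ∘ₗ LinearMap.mulLeft k (HopfAlgebra.antipode k y)).rTensor H X) =
        TensorProduct.lid k H (l.rTensor H ((HopfAlgebra.antipode k y ⊗ₜ (1 : H)) * X)) := by
      intro X
      induction X with
      | zero => simp
      | add u v hu hv => simp only [map_add, mul_add, hu, hv]
      | tmul c d => simp
    have h3 : ∀ X : H ⊗[k] H, TensorProduct.lid k H (l.rTensor H (((1 : H) ⊗ₜ y) * X)) =
        y * TensorProduct.lid k H (l.rTensor H X) := by
      intro X
      induction X with
      | zero => simp
      | add u v hu hv => simp only [map_add, mul_add, hu, hv]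
      | tmul c d => simp
    have h4 := ht' 1
    rw [mul_one, Bialgebra.counit_one] at h4
    rw [lTrans_apply, h2, antipode_tmul_one_mul_comul htl, h3, ← lTrans_apply, hl, h4]
    simp
  -- `φ ↦ φ(t₁)t₂` is onto by `hleft`, hence injective by dimension; it sends both `l(· a)` and
  -- `l(S²(a) ·)` to `S(a)`.
  let Ψ : Module.Dual k H →ₗ[k] H :=
    { toFun := fun φ ↦ lTrans φ t
      map_add' := fun φ ψ ↦ lTrans_add φ ψ t
      map_smul' := fun c φ ↦ lTrans_smul c φ t }
  have hΨ : Function.Injective Ψ :=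
    (LinearMap.injective_iff_surjective_of_finrank_eq_finrank hdim.symm).2 fun y ↦ ⟨_, hleft y⟩
  have h5 : l ∘ₗ LinearMap.mulRight k a =
      l ∘ₗ LinearMap.mulLeft k (HopfAlgebra.antipode k (HopfAlgebra.antipode k a)) :=
    hΨ ((hright a).trans (hleft _).symm)
  exact LinearMap.congr_fun h5 x

end Nakayama

section Tensors

variable {k C : Type*} [Field k] [AddCommGroup C] [Module k C]

theorem eq_of_map_apply_eq [FiniteDimensional k C] {X Y : C ⊗[k] C}
    (h : ∀ φ ψ : C →ₗ[k] k, LinearMap.mul' k k (TensorProduct.map φ ψ X) =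
      LinearMap.mul' k k (TensorProduct.map φ ψ Y)) : X = Y := by
  let b := Module.finBasis k C
  refine (b.tensorProduct b).ext_elem fun ⟨i, j⟩ ↦ ?_
  have h1 : ∀ Z : C ⊗[k] C, (b.tensorProduct b).repr Z (i, j) =
      LinearMap.mul' k k (TensorProduct.map (b.coord i) (b.coord j) Z) := by
    intro Z
    induction Z with
    | zero => simp
    | add x y hx hy => simp only [map_add, Finsupp.add_apply, hx, hy]
    | tmul x y => simp [Module.Basis.tensorProduct_repr_tmul_apply, mul_comm]
  rw [h1, h1, h]

end Tensors

/-! ### Matrix subcoalgebras over an algebraically closed field -/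

section MatrixCoalgebra

variable {k C : Type*} [Field k] [AddCommGroup C] [Module k C] [Coalgebra k C]

/-- Modulo its radical the algebra is a nonempty product of matrix algebras by Wedderburn; project
onto one factor. -/
theorem exists_algHom_matrix (R : Type*) [IsAlgClosed k] [Ring R] [Algebra k R]
    [FiniteDimensional k R] [Nontrivial R] : ∃ (n : ℕ) (_ : NeZero n)
      (ρ : R →ₐ[k] Matrix (Fin n) (Fin n) k), Function.Surjective ρ := by
  have : IsArtinianRing R := IsArtinianRing.of_finite k R
  have : IsSemisimpleRing (R ⧸ Ring.jacobson R) := inferInstance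
  have : Nontrivial (R ⧸ Ring.jacobson R) :=
    Ideal.Quotient.nontrivial_iff.2 (Ring.jacobson_lt_top R).ne
  obtain ⟨n, d, hd, ⟨e⟩⟩ :=
    IsSemisimpleRing.exists_algEquiv_pi_matrix_of_isAlgClosed k (R ⧸ Ring.jacobson R)
  have hn : Nonempty (Fin n) := by
    by_contra hc
    rw [not_nonempty_iff] at hc
    exact not_subsingleton _ e.toEquiv.subsingleton
  obtain ⟨i⟩ := hn
  refine ⟨d i, hd i, ((Pi.evalAlgHom k _ i).comp e.toAlgHom).comp
    (Ideal.Quotient.mkₐ k (Ring.jacobson R)), ?_⟩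
  exact ((Function.surjective_eval i).comp e.surjective).comp Ideal.Quotient.mk_surjective

open WithConv in
/-- A nonzero finite-dimensional coalgebra over an algebraically closed field contains a
matrix coalgebra. -/
theorem exists_matrix_coalgebra [IsAlgClosed k] [FiniteDimensional k C] [Nontrivial C] :
    ∃ (n : ℕ) (_ : NeZero n) (X : Matrix (Fin n) (Fin n) C),
      (∀ i j, Coalgebra.comul (R := k) (X i j) = ∑ l, X i l ⊗ₜ[k] X l j) ∧
      (∀ i j, Coalgebra.counit (R := k) (X i j) = (1 : Matrix (Fin n) (Fin n) k) i j) ∧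
      ∀ A : Matrix (Fin n) (Fin n) k, ∃ φ : C →ₗ[k] k, X.map φ = A := by
  have : FiniteDimensional k (WithConv (C →ₗ[k] k)) :=
    Module.Finite.equiv (WithConv.linearEquiv k (C →ₗ[k] k)).symm
  have : Nontrivial (WithConv (C →ₗ[k] k)) :=
    (WithConv.equiv (Module.Dual k C)).nontrivial
  obtain ⟨n, hn, ρ, hρ⟩ := exists_algHom_matrix (k := k) (WithConv (C →ₗ[k] k))
  let ev : Fin n → Fin n → Module.Dual k (Module.Dual k C) := fun i j ↦
    Matrix.entryLinearMap k k i j ∘ₗ ρ.toLinearMap ∘ₗ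
      (WithConv.linearEquiv k (C →ₗ[k] k)).symm.toLinearMap
  -- The matrix coefficients of `ρ`, seen in `C` through biduality. Multiplicativity of `ρ` gives
  -- their comultiplication, and surjectivity their independence.
  let X : Matrix (Fin n) (Fin n) C := Matrix.of fun i j ↦ (Module.evalEquiv k C).symm (ev i j)
  have hX : ∀ (φ : C →ₗ[k] k) i j, φ (X i j) = ρ (toConv φ) i j := by
    intro φ i j
    exact Module.apply_evalEquiv_symm_apply k C φ (ev i j)
  refine ⟨n, hn, X, fun i j ↦ ?_, fun i j ↦ ?_, fun A ↦ ?_⟩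
  · refine eq_of_map_apply_eq fun φ ψ ↦ ?_
    have h1 := hX (toConv φ * toConv ψ).ofConv i j
    rw [toConv_ofConv, map_mul, Matrix.mul_apply] at h1
    refine h1.trans ?_
    simp [hX]
  · rw [hX]
    have h1 : toConv (Coalgebra.counit (R := k) (A := C)) = 1 := by
      ext x
      simp
    rw [h1, map_one]
  · obtain ⟨φ, hφ⟩ := hρ A
    refine ⟨φ.ofConv, ?_⟩
    ext i j
    rw [Matrix.map_apply, hX, toConv_ofConv, hφ]

end MatrixCoalgebra

end CoalgebraTwist

/-! ### The one-sided twisted coalgebra -/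

namespace HopfTwist

variable {k H : Type*} [Field k] [Ring H] [HopfAlgebra k H]

/-- The scalar `(ε ⊗ id)(J) = (id ⊗ ε)(J)`. -/
def scalar (J : HopfTwist k H) : k := J.exists_scalar.choose

theorem eL_elt (J : HopfTwist k H) : eL (J.elt : H ⊗[k] H) = algebraMap k H J.scalar :=
  J.exists_scalar.choose_spec.1

theorem eR_elt (J : HopfTwist k H) : eR (J.elt : H ⊗[k] H) = algebraMap k H J.scalar :=
  J.exists_scalar.choose_spec.2

theorem scalar_ne_zero [Nontrivial H] (J : HopfTwist k H) : J.scalar ≠ 0 := by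
  intro h
  have h1 := J.eL_inv_mul
  rw [eL_elt, h, map_zero, mul_zero] at h1
  exact zero_ne_one h1

/-- The one-sided twisted comultiplication `h ↦ Δ(h) J`. -/
def comulRight (J : HopfTwist k H) : H →ₗ[k] H ⊗[k] H :=
  LinearMap.mulRight k (J.elt : H ⊗[k] H) ∘ₗ Coalgebra.comul

theorem comulRight_apply (J : HopfTwist k H) (h : H) :
    J.comulRight h = Coalgebra.comul (R := k) h * (J.elt : H ⊗[k] H) := rfl

theorem assoc_rTensor_comulRight (J : HopfTwist k H) (X : H ⊗[k] H) :
    TensorProduct.assoc k H H H (J.comulRight.rTensor H X) =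
      f1 X * i1 (J.elt : H ⊗[k] H) := by
  induction X with
  | zero => simp
  | add x y hx hy => simp only [map_add, add_mul, hx, hy]
  | tmul a b =>
    have : J.comulRight.rTensor H (a ⊗ₜ[k] b) =
        (Coalgebra.comul (R := k) a ⊗ₜ[k] b) * ((J.elt : H ⊗[k] H) ⊗ₜ[k] (1 : H)) := by
      simp [comulRight_apply]
    rw [this]
    exact map_mul (Algebra.TensorProduct.assoc k k k H H H) _ _

theorem lTensor_comulRight (J : HopfTwist k H) (X : H ⊗[k] H) :
    J.comulRight.lTensor H X = f2 X * i2 (J.elt : H ⊗[k] H) := by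
  induction X with
  | zero => simp
  | add x y hx hy => simp only [map_add, add_mul, hx, hy]
  | tmul a b => simp [comulRight_apply, i2, f2]

/-- The coalgebra with comultiplication `h ↦ Δ(h) J` on a copy of `H`. -/
@[nolint unusedArguments]
def RightTwisted {k H : Type*} [Field k] [Ring H] [HopfAlgebra k H] (_J : HopfTwist k H) :
    Type _ := H

instance (J : HopfTwist k H) : AddCommGroup J.RightTwisted := inferInstanceAs (AddCommGroup H)

instance (J : HopfTwist k H) : Module k J.RightTwisted := inferInstanceAs (Module k H)

/-- The coalgebra structure `h ↦ Δ(h) J`, with the counit rescaled accordingly. -/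
abbrev coalgebraRight [Nontrivial H] (J : HopfTwist k H) : Coalgebra k H where
  comul := J.comulRight
  counit := J.scalar⁻¹ • Coalgebra.counit
  coassoc := by
    ext h
    simp only [LinearMap.coe_comp, LinearEquiv.coe_coe, Function.comp_apply]
    rw [assoc_rTensor_comulRight, lTensor_comulRight, comulRight_apply]
    simp only [map_mul, f1_comul, mul_assoc, twist_eq']
  rTensor_counit_comp_comul := by
    ext h
    apply (TensorProduct.lid k H).injective
    have h1 := congrArg (J.scalar⁻¹ • ·) (map_mul eL (Coalgebra.comul (R := k) h)
      (J.elt : H ⊗[k] H))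
    simp only [eL_comul, eL_elt, ← Algebra.commutes, ← Algebra.smul_def, smul_smul,
      inv_mul_cancel₀ J.scalar_ne_zero, one_smul] at h1
    rw [LinearMap.rTensor_smul]
    rw [LinearMap.comp_apply, LinearMap.smul_apply, map_smul]
    refine h1.trans ?_
    simp
  lTensor_counit_comp_comul := by
    ext h
    apply (TensorProduct.rid k H).injective
    have h1 := congrArg (J.scalar⁻¹ • ·) (map_mul eR (Coalgebra.comul (R := k) h)
      (J.elt : H ⊗[k] H))
    simp only [eR_comul, eR_elt, ← Algebra.commutes, ← Algebra.smul_def, smul_smul,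
      inv_mul_cancel₀ J.scalar_ne_zero, one_smul] at h1
    rw [LinearMap.lTensor_smul]
    rw [LinearMap.comp_apply, LinearMap.smul_apply, map_smul]
    refine h1.trans ?_
    simp

instance [Nontrivial H] (J : HopfTwist k H) : Coalgebra k J.RightTwisted := J.coalgebraRight

/-- A matrix over `H` with linearly independent entries that is comultiplicative for the
one-sided twisted comultiplication `h ↦ Δ(h) J`. -/
structure ComatrixBasis (J : HopfTwist k H) (n : ℕ) where
  /-- The underlying matrix. -/
  X : Matrix (Fin n) (Fin n) H
  comul_X_mul : ∀ i j,
    Coalgebra.comul (R := k) (X i j) * (J.elt : H ⊗[k] H) = ∑ l, X i l ⊗ₜ[k] X l j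
  counit_X : ∀ i j, Coalgebra.counit (R := k) (X i j) = if i = j then J.scalar else 0
  exists_map_eq : ∀ A : Matrix (Fin n) (Fin n) k, ∃ φ : H →ₗ[k] k, ∀ i j, φ (X i j) = A i j

theorem exists_comatrixBasis [IsAlgClosed k] [FiniteDimensional k H] [Nontrivial H]
    (J : HopfTwist k H) : ∃ (n : ℕ) (_ : NeZero n), Nonempty (J.ComatrixBasis n) := by
  have : FiniteDimensional k J.RightTwisted := inferInstanceAs (FiniteDimensional k H)
  have : Nontrivial J.RightTwisted := inferInstanceAs (Nontrivial H)
  obtain ⟨n, hn, X, h1, h2, h3⟩ :=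
    CoalgebraTwist.exists_matrix_coalgebra (k := k) (C := J.RightTwisted)
  refine ⟨n, hn, ⟨X, h1, fun i j ↦ ?_, fun A ↦ ?_⟩⟩
  · have h4 : J.scalar⁻¹ * Coalgebra.counit (R := k) (A := H) (X i j) =
      (1 : Matrix (Fin n) (Fin n) k) i j := h2 i j
    rw [inv_mul_eq_iff_eq_mul₀ J.scalar_ne_zero] at h4
    rw [h4, Matrix.one_apply]
    split_ifs <;> simp
  · obtain ⟨φ, hφ⟩ := h3 A
    exact ⟨φ, fun i j ↦ congrFun (congrFun hφ i) j⟩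

theorem Q_mul_Qinv [FiniteDimensional k H] (J : HopfTwist k H) : J.Q * J.Qinv = 1 := by
  have : IsArtinianRing H := IsArtinianRing.of_finite k H
  exact mul_eq_one_symm J.Qinv_mul_Q

theorem lid_rTensor_mul_mul (l : H →ₗ[k] k) (x x' y y' : H) (T : H ⊗[k] H) :
    TensorProduct.lid k H (l.rTensor H ((x ⊗ₜ x') * T * (y ⊗ₜ y'))) =
      x' * TensorProduct.lid k H
        ((l ∘ₗ LinearMap.mulLeft k x ∘ₗ LinearMap.mulRight k y).rTensor H T) * y' := by
  induction T with
  | zero => simp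
  | add u v hu hv => simp only [map_add, mul_add, add_mul, hu, hv]
  | tmul u v => simp [mul_assoc]

/-! ### From a comatrix basis to an integral for the twisted comultiplication -/

namespace ComatrixBasis

variable {n : ℕ} {J : HopfTwist k H} (M : J.ComatrixBasis n)

/-- The inverse of the matrix `X`. -/
def Y : Matrix (Fin n) (Fin n) H :=
  Matrix.of fun i j ↦ J.scalar⁻¹ • (J.Qinv * HopfAlgebra.antipode k (M.X i j))

theorem Y_apply (i j : Fin n) :
    M.Y i j = J.scalar⁻¹ • (J.Qinv * HopfAlgebra.antipode k (M.X i j)) := rfl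

/-- Apply `x ⊗ y ↦ x Q_J⁻¹ S(y)` to `comul_X_mul`: the factor `J` is absorbed by `G_Qinv`, leaving
`X₁S(X₂)`. -/
theorem X_mul_Y [Nontrivial H] : M.X * M.Y = 1 := by
  ext i j
  have h1 := congrArg (G J.Qinv) (M.comul_X_mul i j)
  rw [G_mul, G_Qinv, G_one_comul, counit_X, map_sum] at h1
  rw [Matrix.mul_apply, Matrix.one_apply]
  simp only [Y_apply, mul_smul_comm, ← mul_assoc, ← G_tmul, ← Finset.smul_sum, ← h1]
  split_ifs <;> simp [Algebra.algebraMap_eq_smul_one, smul_smul, J.scalar_ne_zero]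

theorem Y_mul_X [Nontrivial H] : M.Y * M.X = 1 := by
  ext i j
  have h1 := congrArg (F 1) (M.comul_X_mul i j)
  rw [F_mul, F_one_comul, F_algebraMap, F_one_elt, counit_X, map_sum] at h1
  have h2 : ∀ l, M.Y i l * M.X l j = J.scalar⁻¹ • (J.Qinv * F 1 (M.X i l ⊗ₜ[k] M.X l j)) := by
    intro l
    simp [Y_apply, F_tmul, mul_assoc]
  rw [Matrix.mul_apply, Matrix.one_apply]
  simp only [h2, ← Finset.smul_sum, ← Finset.mul_sum, ← h1]
  split_ifs <;> simp [smul_smul, J.scalar_ne_zero, J.Qinv_mul_Q]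

theorem antipode_X [Nontrivial H] [FiniteDimensional k H] (i j : Fin n) :
    HopfAlgebra.antipode k (M.X i j) = J.scalar • (J.Q * M.Y i j) := by
  rw [Y_apply, mul_smul_comm, smul_smul, mul_inv_cancel₀ J.scalar_ne_zero, one_smul, ← mul_assoc,
    Q_mul_Qinv, one_mul]

/-- Inverting `Δ(X)J = (X ⊗ 1)(1 ⊗ X)` as matrices over `H ⊗ H` gives `Δ(Y) = J(1 ⊗ Y)(Y ⊗ 1)`. -/
theorem comul_Y [Nontrivial H] (i j : Fin n) : Coalgebra.comul (R := k) (M.Y i j) =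
    (J.elt : H ⊗[k] H) * ∑ l, M.Y l j ⊗ₜ[k] M.Y i l := by
  let δ := (Bialgebra.comulAlgHom k H).toRingHom.mapMatrix (m := Fin n)
  let ι₁ := (Algebra.TensorProduct.includeLeft (R := k) (S := k) (A := H)
    (B := H)).toRingHom.mapMatrix (m := Fin n)
  let ι₂ := (Algebra.TensorProduct.includeRight (R := k) (A := H) (B := H)).toRingHom.mapMatrix
    (m := Fin n)
  let D : Matrix (Fin n) (Fin n) (H ⊗[k] H) := Matrix.diagonal fun _ ↦ (J.elt : H ⊗[k] H)
  have h1 : δ M.X * D = ι₁ M.X * ι₂ M.X := by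
    ext i j
    rw [Matrix.mul_diagonal, Matrix.mul_apply]
    simpa [δ, ι₁, ι₂] using M.comul_X_mul i j
  have h2 : δ M.X * (D * ι₂ M.Y * ι₁ M.Y) = 1 := by
    calc _ = δ M.X * D * ι₂ M.Y * ι₁ M.Y := by simp only [mul_assoc]
      _ = ι₁ M.X * (ι₂ M.X * ι₂ M.Y) * ι₁ M.Y := by rw [h1]; simp only [mul_assoc]
      _ = 1 := by rw [← map_mul, X_mul_Y, map_one, mul_one, ← map_mul, X_mul_Y, map_one]
  have h3 : δ M.Y * δ M.X = 1 := by rw [← map_mul, Y_mul_X, map_one]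
  have h4 : δ M.Y = D * ι₂ M.Y * ι₁ M.Y := left_inv_eq_right_inv h3 h2
  have h5 := congrFun (congrFun h4 i) j
  rw [mul_assoc, Matrix.diagonal_mul, Matrix.mul_apply] at h5
  simpa [δ, ι₁, ι₂] using h5

/-- Writing `Δ(h) = J Δ^J(h) J⁻¹`, the outer factors `J` and `J⁻¹` are absorbed by `X` and `Y`. This
is what transports invariance from `Δ` to `Δ^J`. -/
theorem comul_mul_mul [Nontrivial H] (p q a b : Fin n) (h : H) :
    Coalgebra.comul (R := k) (M.X p a * h * M.Y b q) =
      ∑ r, ∑ s, (M.X p r ⊗ₜ[k] M.X r a) * J.comul h * (M.Y s q ⊗ₜ[k] M.Y b s) := by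
  simp only [← Finset.mul_sum, ← Finset.sum_mul]
  rw [← comul_X_mul, comul_apply, Bialgebra.comul_mul, Bialgebra.comul_mul, comul_Y]
  simp only [mul_assoc, Units.mul_inv_cancel_left]

/-- The functional `z ↦ l(X_{pa} z Y_{bq})`. -/
def sandwich (l : H →ₗ[k] k) (p q a b : Fin n) : H →ₗ[k] k :=
  l ∘ₗ LinearMap.mulLeft k (M.X p a) ∘ₗ LinearMap.mulRight k (M.Y b q)

theorem sandwich_apply (l : H →ₗ[k] k) (p q a b : Fin n) (h : H) :
    M.sandwich l p q a b h = l (M.X p a * h * M.Y b q) := by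
  simp [sandwich, mul_assoc]

theorem sum_lid_sandwich [Nontrivial H] {l : H →ₗ[k] k}
    (hl : ∀ h, CoalgebraTwist.lTrans l h = l h • (1 : H)) (p q a b : Fin n) (h : H) :
    ∑ r, ∑ s, M.X r a * TensorProduct.lid k H
      ((M.sandwich l p q r s).rTensor H (J.comul h)) * M.Y b s =
        M.sandwich l p q a b h • (1 : H) := by
  rw [sandwich_apply, ← hl, CoalgebraTwist.lTrans_apply, comul_mul_mul]
  simp only [map_sum, lid_rTensor_mul_mul]
  rfl

theorem sum_smul_X_mul_Y [Nontrivial H] {l : H →ₗ[k] k}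
    (hr : ∀ h, CoalgebraTwist.rTrans l h = l h • (1 : H)) (p q a b : Fin n) :
    ∑ r, ∑ s, l (M.X r a * M.Y b s) • (M.X p r * M.Y s q) =
      l (M.X p a * M.Y b q) • (1 : H) := by
  have h1 := hr (M.X p a * 1 * M.Y b q)
  have h2 : J.comul 1 = 1 := by
    rw [comul_apply, Bialgebra.comul_one, one_mul, Units.inv_mul]
  rw [CoalgebraTwist.rTrans_apply, comul_mul_mul, h2] at h1
  simpa using h1

theorem commute_of_commute_X {N : Matrix (Fin n) (Fin n) k}
    (h : Commute M.X (N.map (algebraMap k H))) (A : Matrix (Fin n) (Fin n) k) :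
    Commute A N := by
  obtain ⟨φ, hφ⟩ := M.exists_map_eq A
  ext i j
  have h1 := congrArg φ (congrFun (congrFun h i) j)
  simpa [Matrix.mul_apply, Algebra.algebraMap_eq_smul_one, hφ, mul_comm] using h1

/-- Schur's lemma: for fixed `a`, `b`, right invariance says that the scalar matrix array `N_pq =
l(X_pa Y_bq)` satisfies `X N Y = N`. Hence `N` commutes with `X`, then with every matrix over `k`,
and is a multiple of the identity. -/
theorem exists_integral_X_mul_Y [Nontrivial H] [NeZero n] {l : H →ₗ[k] k}
    (hr : ∀ h, CoalgebraTwist.rTrans l h = l h • (1 : H)) :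
    ∃ f : Matrix (Fin n) (Fin n) k, ∀ p q a b,
      l (M.X p a * M.Y b q) = if p = q then f a b else 0 := by
  refine ⟨Matrix.of fun a b ↦ l (M.X 0 a * M.Y b 0), fun p q a b ↦ ?_⟩
  let N : Matrix (Fin n) (Fin n) k := Matrix.of fun p q ↦ l (M.X p a * M.Y b q)
  have h1 : M.X * N.map (algebraMap k H) * M.Y = N.map (algebraMap k H) := by
    ext p q
    have h2 := M.sum_smul_X_mul_Y hr p q a b
    rw [Matrix.map_apply, Algebra.algebraMap_eq_smul_one]
    refine Eq.trans ?_ h2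
    simp only [Matrix.mul_apply, Finset.sum_mul, Matrix.map_apply, N, Matrix.of_apply,
      Algebra.algebraMap_eq_smul_one, mul_smul_comm, mul_one, smul_mul_assoc]
    exact Finset.sum_comm
  have h3 : Commute M.X (N.map (algebraMap k H)) := by
    have h4 := congrArg (· * M.X) h1
    simp only [mul_assoc, Y_mul_X, mul_one] at h4
    exact h4
  obtain ⟨c, hc⟩ := Matrix.mem_range_scalar_of_commute_single (M := N)
    fun i j _ ↦ M.commute_of_commute_X h3 _
  have h5 : ∀ p q, l (M.X p a * M.Y b q) = if p = q then c else 0 := by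
    intro p q
    have h6 := congrFun (congrFun hc p) q
    rw [Matrix.scalar_apply, Matrix.diagonal_apply] at h6
    exact h6.symm
  rw [h5, Matrix.of_apply, h5, if_pos rfl]

/-- The inverse of the transpose of the matrix `Y`. -/
def W : Matrix (Fin n) (Fin n) H :=
  Matrix.of fun i j ↦ J.scalar • (HopfAlgebra.antipode k (M.Y j i) * J.Q)

theorem W_apply (i j : Fin n) :
    M.W i j = J.scalar • (HopfAlgebra.antipode k (M.Y j i) * J.Q) := rfl

/-- Over a noncommutative ring, transposing does not preserve inverses. The antipode reverses
products, so applying it to `Y X = 1` and conjugating by `Q_J` supplies the inverse. -/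
theorem Y_transpose_mul_W [Nontrivial H] [FiniteDimensional k H] : M.Y.transpose * M.W = 1 := by
  ext j t
  have h1 := congrArg (HopfAlgebra.antipode k) (congrFun (congrFun M.Y_mul_X t) j)
  rw [Matrix.mul_apply, map_sum] at h1
  simp only [HopfAlgebra.antipode_mul_antidistrib, antipode_X] at h1
  have h2 : J.Qinv * (∑ i, J.scalar • (J.Q * M.Y i j) * HopfAlgebra.antipode k (M.Y t i)) * J.Q =
      (M.Y.transpose * M.W) j t := by
    rw [Matrix.mul_apply, Finset.mul_sum, Finset.sum_mul]
    refine Finset.sum_congr rfl fun i _ ↦ ?_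
    simp only [Matrix.transpose_apply, W_apply, smul_mul_assoc, mul_smul_comm]
    rw [mul_assoc J.Q, ← mul_assoc J.Qinv, Qinv_mul_Q, one_mul, mul_assoc]
  rw [← h2, h1, Matrix.one_apply, Matrix.one_apply]
  by_cases h : t = j
  · subst h
    simp [HopfAlgebra.antipode_one, Qinv_mul_Q]
  · rw [if_neg h, if_neg (Ne.symm h)]
    simp

variable {l : H →ₗ[k] k} {f : Matrix (Fin n) (Fin n) k}

theorem trace_eq_one [Nontrivial H] [NeZero n] (h1 : l 1 = 1)
    (hf : ∀ p q a b, l (M.X p a * M.Y b q) = if p = q then f a b else 0) : f.trace = 1 := by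
  have h2 := congrArg l (congrFun (congrFun M.X_mul_Y 0) 0)
  rw [Matrix.mul_apply, map_sum, Matrix.one_apply, if_pos rfl, h1] at h2
  simpa [hf, Matrix.trace] using h2

/-- Left invariance at `h = 1` reads `Xᵀ f Yᵀ = f`; then cancel `Yᵀ`. -/
theorem X_transpose_mul [Nontrivial H] [FiniteDimensional k H] [NeZero n]
    (hl : ∀ h, CoalgebraTwist.lTrans l h = l h • (1 : H))
    (hf : ∀ p q a b, l (M.X p a * M.Y b q) = if p = q then f a b else 0) :
    M.X.transpose * f.map (algebraMap k H) = f.map (algebraMap k H) * M.W := by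
  have h1 : M.X.transpose * f.map (algebraMap k H) * M.Y.transpose = f.map (algebraMap k H) := by
    ext a b
    have h2 := M.sum_lid_sandwich hl 0 0 a b 1
    have h3 : J.comul 1 = 1 := by
      rw [comul_apply, Bialgebra.comul_one, one_mul, Units.inv_mul]
    simp only [h3, Algebra.TensorProduct.one_def, LinearMap.rTensor_tmul, TensorProduct.lid_tmul,
      sandwich_apply, mul_one, hf, if_true] at h2
    rw [Matrix.map_apply, Algebra.algebraMap_eq_smul_one, ← h2]
    simp only [Matrix.mul_apply, Finset.sum_mul, Matrix.map_apply, Matrix.transpose_apply,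
      Algebra.algebraMap_eq_smul_one]
    exact Finset.sum_comm
  conv_rhs => rw [← h1, mul_assoc, Y_transpose_mul_W, mul_one]

/-- A functional taking `Xᵀ` to `A` turns `hW` into `A f = f B`, so the image of `f` is stable under
all matrices. Matrix units move a nonzero entry `f i j` to every basis vector. -/
theorem exists_right_inverse [NeZero n] (h0 : f ≠ 0)
    (hW : M.X.transpose * f.map (algebraMap k H) = f.map (algebraMap k H) * M.W) :
    ∃ g, f * g = 1 := by
  obtain ⟨i, j, hij⟩ : ∃ i j, f i j ≠ 0 := by
    by_contra! hc
    exact h0 (Matrix.ext hc)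
  have h1 : ∀ A : Matrix (Fin n) (Fin n) k, ∃ B, A * f = f * B := by
    intro A
    obtain ⟨φ, hφ⟩ := M.exists_map_eq A.transpose
    refine ⟨Matrix.of fun a b ↦ φ (M.W a b), ?_⟩
    ext a b
    have h2 := congrArg φ (congrFun (congrFun hW a) b)
    simpa [Matrix.mul_apply, Algebra.algebraMap_eq_smul_one, hφ, mul_comm] using h2
  choose B hB using fun s ↦ h1 (Matrix.single s i 1)
  refine ⟨Matrix.of fun a b ↦ (f i j)⁻¹ * B b a j, ?_⟩
  ext a b
  have h3 := congrFun (congrFun (hB b) a) j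
  rw [Matrix.mul_apply (M := f)] at h3
  simp only [Matrix.mul_apply, Matrix.of_apply, mul_left_comm _ (f i j)⁻¹]
  rw [← Finset.mul_sum, ← h3, Matrix.one_apply]
  by_cases hab : a = b
  · subst hab
    simp [hij]
  · simp [hab]

/-- Apply `S` to the `(p, b)` entry of `hW` and cancel `S(Q_J)`. This is where the element
`S(Q_J⁻¹)Q_J` arises. -/
theorem sum_smul_antipode_antipode_Y [Nontrivial H] [FiniteDimensional k H]
    (hW : M.X.transpose * f.map (algebraMap k H) = f.map (algebraMap k H) * M.W) (p b : Fin n) :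
    ∑ q, f p q • HopfAlgebra.antipode k (HopfAlgebra.antipode k (M.Y b q)) =
      ∑ j, f j b • (HopfAlgebra.antipode k J.Qinv * J.Q * M.Y j p) := by
  have h1 := congrArg (fun z ↦ J.scalar⁻¹ • (HopfAlgebra.antipode k J.Qinv *
    HopfAlgebra.antipode k z)) (congrFun (congrFun hW p) b)
  have h2 : HopfAlgebra.antipode k J.Qinv * HopfAlgebra.antipode k J.Q = 1 := by
    rw [← HopfAlgebra.antipode_mul_antidistrib, Q_mul_Qinv, HopfAlgebra.antipode_one]
  simp only [Matrix.mul_apply, map_sum, Matrix.map_apply, Matrix.transpose_apply,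
    Algebra.algebraMap_eq_smul_one, mul_smul_comm, smul_mul_assoc, mul_one, one_mul, map_smul,
    antipode_X, W_apply, HopfAlgebra.antipode_mul_antidistrib, Finset.mul_sum,
    Finset.smul_sum] at h1
  symm
  refine Eq.trans (Finset.sum_congr rfl fun j _ ↦ ?_)
    (h1.trans (Finset.sum_congr rfl fun q _ ↦ ?_))
  · rw [smul_comm (f j b) J.scalar, smul_smul, inv_mul_cancel₀ J.scalar_ne_zero, one_smul,
      mul_assoc]
  · rw [smul_smul, inv_mul_cancel₀ J.scalar_ne_zero, one_smul,
      ← mul_assoc, h2, one_mul]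

/-- The Nakayama property moves `Y_bq` to the front as `S²(Y_bq)`; the weighted sum over `q` turns
it into entries of `Y`, which then cancel against `X`. -/
theorem sum_smul_sandwich [Nontrivial H] [FiniteDimensional k H]
    (hu : ∀ a x, l (x * a) = l (HopfAlgebra.antipode k (HopfAlgebra.antipode k a) * x))
    (hW : M.X.transpose * f.map (algebraMap k H) = f.map (algebraMap k H) * M.W) (a b : Fin n) :
    ∑ p, ∑ q, f p q • M.sandwich l p q a b =
      f a b • (l ∘ₗ LinearMap.mulLeft k (HopfAlgebra.antipode k J.Qinv * J.Q)) := by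
  ext h
  simp only [LinearMap.sum_apply, LinearMap.smul_apply, sandwich_apply, LinearMap.comp_apply,
    LinearMap.mulLeft_apply]
  have h1 : ∀ p q, l (M.X p a * h * M.Y b q) = l (HopfAlgebra.antipode k
      (HopfAlgebra.antipode k (M.Y b q)) * (M.X p a * h)) := fun p q ↦ hu _ _
  calc _ = l (∑ p, (∑ q, f p q • HopfAlgebra.antipode k (HopfAlgebra.antipode k (M.Y b q))) *
        (M.X p a * h)) := by
        simp only [h1, map_sum, Finset.sum_mul, smul_mul_assoc, map_smul]
    _ = l (∑ j, f j b • (HopfAlgebra.antipode k J.Qinv * J.Q * ((M.Y * M.X) j a * h))) := by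
        simp only [M.sum_smul_antipode_antipode_Y hW, Matrix.mul_apply, Finset.sum_mul,
          Finset.mul_sum, Finset.smul_sum, smul_mul_assoc, mul_assoc]
        rw [Finset.sum_comm]
    _ = _ := by
        rw [Y_mul_X, Finset.sum_eq_single a]
        · simp
        · intro j _ hj
          simp [hj]
        · simp

/-- Evaluating `sum_smul_sandwich` at 1 gives `tr(f) f_aa = f_aa l'(1)`, and trace 1 provides a
nonzero `f_aa`. -/
theorem integral_antipode_Qinv_mul_Q [Nontrivial H] [FiniteDimensional k H] [NeZero n]
    (h1 : l 1 = 1)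
    (hu : ∀ a x, l (x * a) = l (HopfAlgebra.antipode k (HopfAlgebra.antipode k a) * x))
    (hf : ∀ p q a b, l (M.X p a * M.Y b q) = if p = q then f a b else 0)
    (hW : M.X.transpose * f.map (algebraMap k H) = f.map (algebraMap k H) * M.W) :
    l (HopfAlgebra.antipode k J.Qinv * J.Q) = 1 := by
  have ht := M.trace_eq_one h1 hf
  obtain ⟨a, ha⟩ : ∃ a, f a a ≠ 0 := by
    by_contra! hc
    simp [Matrix.trace, hc] at ht
  have h2 := LinearMap.congr_fun (M.sum_smul_sandwich hu hW a a) 1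
  simp only [LinearMap.sum_apply, LinearMap.smul_apply, sandwich_apply, LinearMap.comp_apply,
    LinearMap.mulLeft_apply, mul_one, hf, smul_eq_mul, mul_ite, mul_zero, Finset.sum_ite_eq,
    Finset.mem_univ, if_true, ← Finset.sum_mul] at h2
  have h3 : ∑ i, f i i = 1 := ht
  rw [h3, one_mul] at h2
  exact (mul_eq_left₀ ha).1 h2.symm

theorem lid_integral_comul [Nontrivial H] [FiniteDimensional k H] [NeZero n] (h1 : l 1 = 1)
    (hl : ∀ h, CoalgebraTwist.lTrans l h = l h • (1 : H))
    (hu : ∀ a x, l (x * a) = l (HopfAlgebra.antipode k (HopfAlgebra.antipode k a) * x))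
    (hf : ∀ p q a b, l (M.X p a * M.Y b q) = if p = q then f a b else 0)
    (hW : M.X.transpose * f.map (algebraMap k H) = f.map (algebraMap k H) * M.W) (h : H) :
    TensorProduct.lid k H ((l ∘ₗ LinearMap.mulLeft k
      (HopfAlgebra.antipode k J.Qinv * J.Q)).rTensor H (J.comul h)) =
        l (HopfAlgebra.antipode k J.Qinv * J.Q * h) • (1 : H) := by
  set l' := l ∘ₗ LinearMap.mulLeft k (HopfAlgebra.antipode k J.Qinv * J.Q) with hl'
  set g := TensorProduct.lid k H (l'.rTensor H (J.comul h)) with hg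
  have h0 : f ≠ 0 := by
    rintro rfl
    simpa using M.trace_eq_one h1 hf
  obtain ⟨f', hf'⟩ := M.exists_right_inverse h0 hW
  have hf'' : f'.map (algebraMap k H) * f.map (algebraMap k H) = 1 := by
    rw [← Matrix.map_mul, mul_eq_one_comm.1 hf']
    simp
  let D : Matrix (Fin n) (Fin n) H := Matrix.diagonal fun _ ↦ g
  let c : Matrix (Fin n) (Fin n) H := algebraMap k _ (l' h)
  -- With `g = (l' ⊗ id)Δ^J(h)`, this is `sum_lid_sandwich` weighted by `f_pq`. Replacing `Xᵀ f` by
  -- `f W` and cancelling `f` leaves `W g Yᵀ = l'(h)`; multiplying by `Yᵀ` on the left and `W` on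
  -- the right isolates `g`.
  have h2 : M.X.transpose * f.map (algebraMap k H) * D * M.Y.transpose =
      f.map (algebraMap k H) * c := by
    ext a b
    have h3 : ∀ r s, ∑ p, ∑ q, f p q • TensorProduct.lid k H
        ((M.sandwich l p q r s).rTensor H (J.comul h)) = f r s • g := by
      intro r s
      let act : (H →ₗ[k] k) →ₗ[k] H := (TensorProduct.lid k H).toLinearMap ∘ₗ
        LinearMap.applyₗ (J.comul h) ∘ₗ LinearMap.rTensorHom H
      have h4 := congrArg act (M.sum_smul_sandwich hu hW r s)
      simp only [map_sum, map_smul] at h4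
      exact h4
    calc _ = ∑ r, ∑ s, M.X r a * (f r s • g) * M.Y b s := by
          rw [Matrix.mul_apply, Finset.sum_comm]
          simp only [D, Matrix.mul_diagonal]
          simp only [Matrix.mul_apply, Finset.sum_mul, Matrix.map_apply,
            Matrix.transpose_apply, Algebra.algebraMap_eq_smul_one, mul_smul_comm,
            smul_mul_assoc, mul_one]
      _ = ∑ p, ∑ q, f p q • ∑ r, ∑ s, M.X r a * TensorProduct.lid k H
          ((M.sandwich l p q r s).rTensor H (J.comul h)) * M.Y b s := by
          simp only [← h3, Finset.mul_sum, Finset.sum_mul, Finset.smul_sum, mul_smul_comm,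
            smul_mul_assoc]
          refine (Finset.sum_congr rfl fun r _ ↦ Finset.sum_comm).trans
            (Finset.sum_comm.trans (Finset.sum_congr rfl fun p _ ↦ ?_))
          exact (Finset.sum_congr rfl fun r _ ↦ Finset.sum_comm).trans Finset.sum_comm
      _ = (∑ p, ∑ q, f p q • M.sandwich l p q a b) h • (1 : H) := by
          simp only [M.sum_lid_sandwich hl, LinearMap.sum_apply, LinearMap.smul_apply,
            Finset.sum_smul, smul_assoc]
      _ = _ := by
          rw [M.sum_smul_sandwich hu hW]
          simp [c, Algebra.algebraMap_eq_smul_one, smul_smul, hl', mul_comm]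
  have h5 : M.W * D * M.Y.transpose = c := by
    have h6 := congrArg (f'.map (algebraMap k H) * ·) h2
    simpa only [hW, ← mul_assoc, hf'', one_mul] using h6
  have h7 : D = c := by
    have h8 : M.Y.transpose * M.W * D * (M.Y.transpose * M.W) = c := by
      calc _ = M.Y.transpose * (M.W * D * M.Y.transpose) * M.W := by simp only [mul_assoc]
        _ = c := by
          rw [h5, ← Algebra.commutes (l' h) M.Y.transpose, mul_assoc, Y_transpose_mul_W, mul_one]
    simpa only [Y_transpose_mul_W, one_mul, mul_one] using h8
  have h9 := congrFun (congrFun h7 0) 0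
  simpa [D, c, Matrix.algebraMap_matrix_apply, Algebra.algebraMap_eq_smul_one, hl', mul_assoc] using h9

end ComatrixBasis

end HopfTwist

/-! ### Conclusion -/

open HopfTwist CoalgebraTwist in
theorem isCosemisimple_twisted {k H : Type*} [Field k] [IsAlgClosed k] [Ring H]
    [HopfAlgebra k H] [FiniteDimensional k H] (hcos : IsCosemisimple k H) (huni : IsUnimodular k H)
    (J : HopfTwist k H) : IsCosemisimple k J.Twisted := by
  obtain ⟨l, h1, hl, hr⟩ := exists_integral_of_isCosemisimple hcos
  have : Nontrivial H := ⟨1, 0, fun h ↦ by simp [h] at h1⟩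
  have : FiniteDimensional k J.Twisted := inferInstanceAs (FiniteDimensional k H)
  obtain ⟨n, hn, ⟨M⟩⟩ := J.exists_comatrixBasis
  have hu := integral_mul_comm huni h1 hl
  obtain ⟨f, hf⟩ := M.exists_integral_X_mul_Y hr
  have hW := M.X_transpose_mul hl hf
  let l' : J.Twisted →ₗ[k] k :=
    (l ∘ₗ LinearMap.mulLeft k (HopfAlgebra.antipode k J.Qinv * J.Q) : H →ₗ[k] k)
  have h1' : l' 1 = 1 := by
    refine Eq.trans ?_ (M.integral_antipode_Qinv_mul_Q h1 hu hf hW)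
    exact congrArg l (mul_one (HopfAlgebra.antipode k J.Qinv * J.Q))
  exact (isCoseparabilityForm_of_integral h1'
    fun h ↦ M.lid_integral_comul h1 hl hu hf hW h).isCosemisimple

end

theorem mainTheorem5 {k H : Type*} [Field k] [IsAlgClosed k] [Ring H] [HopfAlgebra k H]
    [FiniteDimensional k H] (hcos : IsCosemisimple k H) (huni : IsUnimodular k H)
    (J : HopfTwist k H) :
    IsCosemisimple k J.Twisted ∧ IsUnimodular k J.Twisted :=
  ⟨isCosemisimple_twisted hcos huni J, huni⟩
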